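/- Let $\mu$ be a finite positive Borel measure on $\mathbb{R}$ whose support $\operatorname{supp}(\mu)$ is compact. For a compact set $K\subset\mathbb{R}$, the logarithmic capacity is $$C(K)=\exp\Bigl(-\inf_{\rho}\iint \log|x-y|^{-1}\,d\rho(x)\,d\rho(y)\Bigr),$$ where $\rho$ runs over the Borel probability measures carried by $K$; the energy integral may be $+\infty$, and $C(K)=0$ if it is $+\infty$ for every $\rho$. Let $P_n(\,\cdot\,;\mu)$, $n\ge 0$, be monic orthogonal polynomials for $\mu$: $P_n(x)=x^n+\text{lower order}$ and $\int P_n P_m\,d\mu=0$ for $n\ne m$. The measure $\mu$ is called regular if $$\lim_{n\to\infty}\|P_n(\,\cdot\,;\mu)\|_{L^2(\mu)}^{1/n}=C(\operatorname{supp}(\mu)).$$ Theorem 6.4. Let $I=[a,b]$ be a closed interval with $I\subset E\subset\mathbb{R}$, where $E$ is compact. Let $\mu$ be a regular measure with $\operatorname{supp}(\mu)\subset E$, and let $\mu\restriction I$ be the measure $(\mu\restriction I)(S)=\mu(I\cap S)$. If $C(\operatorname{supp}(\mu\restriction I))>0$, then $\mu\restriction I$ is regular. -/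

import Mathlib

open MeasureTheory Filter Topology Set
open scoped ENNReal Polynomial

/-- The logarithmic kernel `log |x - y|⁻¹`, with the value `+∞` on the diagonal. -/
noncomputable def logKernel (x y : ℝ) : EReal :=
  ENNReal.log (edist x y)⁻¹

/-- The Coulomb energy `∬ log |x - y|⁻¹ dμ(x) dμ(y)`, as the integral of the positive part of the
kernel minus the integral of the negative part. For a finite measure of compact support the
negative part has a finite integral, and the value `+∞` is allowed. -/
noncomputable def coulombEnergy (μ : Measure ℝ) : EReal :=
  ((∫⁻ p, (logKernel p.1 p.2).toENNReal ∂(μ.prod μ) : ℝ≥0∞) : EReal)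
    - ((∫⁻ p, (-logKernel p.1 p.2).toENNReal ∂(μ.prod μ) : ℝ≥0∞) : EReal)

/-- The logarithmic capacity `exp (-inf E(ρ))` of a compact set `K ⊆ ℝ`, where `ρ` runs over the
Borel probability measures carried by `K`. Since `EReal.exp ⊥ = 0`, the capacity is zero when every
such `ρ` has infinite energy (in particular when `K` is empty). -/
noncomputable def logCapacity (K : Set ℝ) : ℝ≥0∞ :=
  EReal.exp (-(⨅ (ρ : Measure ℝ) (_ : IsProbabilityMeasure ρ) (_ : ρ Kᶜ = 0), coulombEnergy ρ))

/-- `P 0, P 1, P 2, …` are monic orthogonal polynomials for `μ`: the polynomial `P n` is monic of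
degree `n`, and different ones are orthogonal in `L²(μ)`. -/
structure IsMonicOrthogonal (μ : Measure ℝ) (P : ℕ → ℝ[X]) : Prop where
  monic : ∀ n, (P n).Monic
  natDegree : ∀ n, (P n).natDegree = n
  orthogonal : ∀ n m, n ≠ m → ∫ x, (P n).eval x * (P m).eval x ∂μ = 0

/-- A measure of compact support is regular in the sense of Stahl and Totik if its monic
orthogonal polynomials satisfy `lim ‖P n‖^(1/n) = C(supp μ)`, the norm being that of `L²(μ)`.
For a finite measure of compact support such polynomials exist, and the numbers `‖P n‖` do not
depend on their choice. -/
def IsStahlTotikRegular (μ : Measure ℝ) : Prop :=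
  IsCompact μ.support ∧
    ∃ P : ℕ → ℝ[X], IsMonicOrthogonal μ P ∧
      Tendsto (fun n : ℕ => eLpNorm (fun x => (P n).eval x) 2 μ ^ (1 / (n : ℝ))) atTop
        (𝓝 (logCapacity μ.support))

/-! Let `K` and `L` be the supports of `μ` and of its restriction `ν` to `[a, b]`, let `P n` and `Q
n` be their monic orthogonal polynomials, and `τ` and `ω` equilibrium measures of `K` and `L`. The
upper bound limsup ‖Q n‖^(1/n) ≤ C(L) needs no regularity: `Q n` has least norm among monic
polynomials, and Fekete polynomials are small on `L` (`exists_monic_abs_eval_le`). The content is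
the lower bound.

Regularity of `μ` is used as subexponential growth of the orthonormal polynomials
(`eventually_abs_eval_le_of_regular`). Comparing `P n` with powers of Fekete polynomials of `K` at
complex points far from the support (`norm_aeval_mul_le`) shows that every limit `σ` of the zero
distributions of `P n` satisfies ∫ log |z - t| dτ ≤ ∫ log |z - t| dσ there. Such an inequality near
infinity forces equality of all moments, so `σ = τ` (`eq_of_forall_integral_log_le`). By the
principle of descent, |P n| / ‖P n‖ is eventually below e^(εn) at each point where the potential of
`τ` reaches the least energy of `K`. By Frostman's theorem almost every point is such a point for
any measure of finite energy on `K`, in particular for `ω`.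

Suppose now that ‖Q n‖ ≤ (C(L) e^(-ε))^n for infinitely many `n`. Multiplying `Q n` by a high power
of a polynomial that peaks at an interior point `x₀` of `[a, b]` gives a polynomial of comparable
smallness in the L² space of the whole of `μ`. Expanding it in the orthonormal polynomials of `μ`
yields |Q n (x₀)| ≤ (C(L) e^(-ε/2))^n for these `n`, once large, at `ω`-almost every `x₀`
(`eventually_prod_le_of_subexponential`). But ∫ log |Q n| dω is a sum of values of minus the
potential of `ω` at the zeros of `Q n`, hence at least n log C(L), as this potential nowhere exceeds
its value on the support (`scaledPotential_le_minEnergy`). Fatou's lemma makes the two bounds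
contradict each other.

Potentials are taken with log (D / |x - y|), where `D` dominates all distances that occur. The
kernel is then nonnegative, and everything stays in `ℝ≥0∞`. -/

/-! ### The nonnegative logarithmic kernel and its potentials -/

/-- The logarithmic kernel `log (D / |x - y|)`, truncated below at `0`, with value `∞` on the
diagonal. -/
noncomputable def scaledKernel (D x y : ℝ) : ℝ≥0∞ :=
  if x = y then ⊤ else ENNReal.ofReal (Real.log D - Real.log |x - y|)

/-- The continuous truncations of `scaledKernel`. -/
noncomputable def truncKernel (D : ℝ) (n : ℕ) (x y : ℝ) : ℝ≥0∞ :=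
  ENNReal.ofReal (Real.log D - Real.log (max |x - y| (1 / ((n : ℝ) + 1))))

/-- The potential of `ρ` for the kernel `scaledKernel D`. -/
noncomputable def scaledPotential (D : ℝ) (ρ : Measure ℝ) (x : ℝ) : ℝ≥0∞ :=
  ∫⁻ y, scaledKernel D x y ∂ρ

/-- The energy of `ρ` for the kernel `scaledKernel D`. -/
noncomputable def scaledEnergy (D : ℝ) (ρ : Measure ℝ) : ℝ≥0∞ :=
  ∫⁻ x, scaledPotential D ρ x ∂ρ

/-- The least energy of a probability measure carried by `K`. -/
noncomputable def minEnergy (D : ℝ) (K : Set ℝ) : ℝ≥0∞ :=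
  ⨅ (ρ : Measure ℝ) (_ : IsProbabilityMeasure ρ) (_ : ρ Kᶜ = 0), scaledEnergy D ρ

lemma scaledKernel_self (D x : ℝ) : scaledKernel D x x = ⊤ := by simp [scaledKernel]

lemma scaledKernel_of_ne (D : ℝ) {x y : ℝ} (h : x ≠ y) :
    scaledKernel D x y = ENNReal.ofReal (Real.log D - Real.log |x - y|) := by
  simp [scaledKernel, h]

lemma scaledKernel_comm (D x y : ℝ) : scaledKernel D x y = scaledKernel D y x := by
  simp only [scaledKernel, abs_sub_comm x y, eq_comm (a := x)]

lemma truncKernel_le_scaledKernel (D : ℝ) (n : ℕ) (x y : ℝ) :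
    truncKernel D n x y ≤ scaledKernel D x y := by
  by_cases h : x = y
  · simp [h, scaledKernel_self]
  · rw [scaledKernel_of_ne D h, truncKernel]
    apply ENNReal.ofReal_le_ofReal
    have : Real.log |x - y| ≤ Real.log (max |x - y| (1 / ((n : ℝ) + 1))) :=
      Real.log_le_log (abs_pos.2 (sub_ne_zero.2 h)) (le_max_left _ _)
    linarith

lemma truncKernel_mono (D x y : ℝ) : Monotone fun n => truncKernel D n x y := by
  intro m n hmn
  apply ENNReal.ofReal_le_ofReal
  have h1 : (0 : ℝ) < 1 / ((n : ℝ) + 1) := by positivity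
  have h2 : (1 : ℝ) / ((n : ℝ) + 1) ≤ 1 / ((m : ℝ) + 1) := by
    have : (m : ℝ) ≤ n := by exact_mod_cast hmn
    gcongr
  have : Real.log (max |x - y| (1 / ((n : ℝ) + 1)))
      ≤ Real.log (max |x - y| (1 / ((m : ℝ) + 1))) :=
    Real.log_le_log (lt_max_of_lt_right h1) (max_le_max le_rfl h2)
  linarith

lemma tendsto_truncKernel (D x y : ℝ) :
    Tendsto (fun n => truncKernel D n x y) atTop (𝓝 (scaledKernel D x y)) := by
  by_cases h : x = y
  · subst h
    rw [scaledKernel_self]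
    have h0 : Tendsto (fun n : ℕ => Real.log D + Real.log ((n : ℝ) + 1)) atTop atTop := by
      apply tendsto_atTop_add_const_left
      exact Real.tendsto_log_atTop.comp
        (tendsto_atTop_add_const_right _ _ tendsto_natCast_atTop_atTop)
    refine (ENNReal.tendsto_ofReal_atTop.comp h0).congr fun n => ?_
    have h1 : (0 : ℝ) < 1 / ((n : ℝ) + 1) := by positivity
    simp only [Function.comp, truncKernel, sub_self, abs_zero]
    rw [max_eq_right h1.le, one_div, Real.log_inv, sub_neg_eq_add]
  · have hpos : 0 < |x - y| := abs_pos.2 (sub_ne_zero.2 h)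
    have h0 : ∀ᶠ n : ℕ in atTop, 1 / ((n : ℝ) + 1) < |x - y| :=
      tendsto_one_div_add_atTop_nhds_zero_nat.eventually_lt_const hpos
    refine tendsto_nhds_of_eventually_eq ?_
    filter_upwards [h0] with n hn
    rw [truncKernel, max_eq_left hn.le, scaledKernel_of_ne D h]

lemma iSup_truncKernel (D x y : ℝ) : ⨆ n, truncKernel D n x y = scaledKernel D x y :=
  tendsto_nhds_unique (tendsto_atTop_iSup (truncKernel_mono D x y)) (tendsto_truncKernel D x y)

lemma continuous_truncKernel (D : ℝ) (n : ℕ) :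
    Continuous fun p : ℝ × ℝ => truncKernel D n p.1 p.2 := by
  refine ENNReal.continuous_ofReal.comp (continuous_const.sub (Continuous.log (by fun_prop) ?_))
  intro p
  have h1 : (0 : ℝ) < 1 / ((n : ℝ) + 1) := by positivity
  exact (lt_max_of_lt_right h1).ne'

/-- A bound for the truncated kernel. -/
lemma truncKernel_le (D : ℝ) (n : ℕ) (x y : ℝ) :
    truncKernel D n x y ≤ ENNReal.ofReal (Real.log D + Real.log ((n : ℝ) + 1)) := by
  apply ENNReal.ofReal_le_ofReal
  have h1 : (0 : ℝ) < 1 / ((n : ℝ) + 1) := by positivity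
  have : Real.log (1 / ((n : ℝ) + 1)) ≤ Real.log (max |x - y| (1 / ((n : ℝ) + 1))) :=
    Real.log_le_log h1 (le_max_right _ _)
  rw [one_div, Real.log_inv] at this
  rw [one_div]
  linarith

lemma lowerSemicontinuous_scaledKernel (D : ℝ) :
    LowerSemicontinuous fun p : ℝ × ℝ => scaledKernel D p.1 p.2 := by
  simp_rw [← iSup_truncKernel]
  exact lowerSemicontinuous_iSup fun n => (continuous_truncKernel D n).lowerSemicontinuous

lemma measurable_scaledKernel (D : ℝ) :
    Measurable fun p : ℝ × ℝ => scaledKernel D p.1 p.2 :=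
  (lowerSemicontinuous_scaledKernel D).measurable

lemma measurable_scaledKernel_right (D x : ℝ) : Measurable (scaledKernel D x) :=
  (measurable_scaledKernel D).comp (f := fun y => (x, y)) (by fun_prop)

lemma measurable_scaledKernel_left (D y : ℝ) : Measurable fun x => scaledKernel D x y :=
  (measurable_scaledKernel D).comp (f := fun x => (x, y)) (by fun_prop)

lemma measurable_scaledPotential (D : ℝ) (ρ : Measure ℝ) [SFinite ρ] :
    Measurable (scaledPotential D ρ) :=
  Measurable.lintegral_prod_right (measurable_scaledKernel D)

lemma measurable_truncKernel (D : ℝ) (n : ℕ) :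
    Measurable fun p : ℝ × ℝ => truncKernel D n p.1 p.2 := (continuous_truncKernel D n).measurable

lemma measurable_truncKernel_right (D : ℝ) (n : ℕ) (x : ℝ) : Measurable (truncKernel D n x) :=
  (measurable_truncKernel D n).comp (f := fun y => (x, y)) (by fun_prop)

/-- The potential is an increasing limit of potentials of the truncated kernels, which are
continuous by dominated convergence. -/
lemma lowerSemicontinuous_scaledPotential (D : ℝ) (ρ : Measure ℝ) [IsFiniteMeasure ρ] :
    LowerSemicontinuous (scaledPotential D ρ) := by
  have h : ∀ x, scaledPotential D ρ x = ⨆ n, ∫⁻ y, truncKernel D n x y ∂ρ := by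
    intro x
    simp_rw [scaledPotential, ← iSup_truncKernel]
    rw [lintegral_iSup]
    · intro n; exact measurable_truncKernel_right D n x
    · intro m n hmn y; exact truncKernel_mono D x y hmn
  rw [funext h]
  refine lowerSemicontinuous_iSup fun n => Continuous.lowerSemicontinuous ?_
  rw [continuous_iff_continuousAt]
  intro x
  refine tendsto_lintegral_filter_of_dominated_convergence
    (fun _ => ENNReal.ofReal (Real.log D + Real.log ((n : ℝ) + 1)))
    (Eventually.of_forall fun y => measurable_truncKernel_right D n y)
    (Eventually.of_forall fun y => Eventually.of_forall fun z => truncKernel_le D n y z)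
    ?_ (Eventually.of_forall fun y => ?_)
  · rw [lintegral_const]
    exact ENNReal.mul_ne_top ENNReal.ofReal_ne_top (measure_ne_top _ _)
  · exact ((continuous_truncKernel D n).comp (Continuous.prodMk_left y)).tendsto x

/-- Integrating one potential against another measure is symmetric. -/
lemma lintegral_scaledPotential_comm (D : ℝ) (ρ σ : Measure ℝ) [SFinite ρ] [SFinite σ] :
    ∫⁻ x, scaledPotential D ρ x ∂σ = ∫⁻ x, scaledPotential D σ x ∂ρ := by
  simp only [scaledPotential]
  rw [lintegral_lintegral_swap (measurable_scaledKernel D).aemeasurable]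
  simp_rw [scaledKernel_comm D]

/-! ### Sums of kernels and products of distances -/

/-- The hypothesis `hx` keeps the truncation at `0` inactive; otherwise factors larger than `D`
would be invisible to the sum. -/
lemma prod_abs_sub_le {D : ℝ} (hD : 0 < D) {ι : Type*} (s : Finset ι) (y : ι → ℝ) (x c : ℝ)
    (hx : ∀ i ∈ s, |x - y i| ≤ D)
    (h : ENNReal.ofReal c ≤ ∑ i ∈ s, scaledKernel D x (y i)) :
    ∏ i ∈ s, |x - y i| ≤ D ^ s.card * Real.exp (-c) := by
  by_cases h0 : ∃ i ∈ s, x = y i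
  · obtain ⟨i, hi, hxi⟩ := h0
    rw [Finset.prod_eq_zero hi (by simp [hxi])]
    positivity
  push Not at h0
  have hpos : ∀ i ∈ s, 0 < |x - y i| := fun i hi => abs_pos.2 (sub_ne_zero.2 (h0 i hi))
  have e : ∑ i ∈ s, scaledKernel D x (y i)
      = ENNReal.ofReal (∑ i ∈ s, (Real.log D - Real.log |x - y i|)) := by
    rw [ENNReal.ofReal_sum_of_nonneg]
    · exact Finset.sum_congr rfl fun i hi => scaledKernel_of_ne D (h0 i hi)
    · intro i hi
      exact sub_nonneg.2 (Real.log_le_log (hpos i hi) (hx i hi))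
  rw [e] at h
  have h2 : c ≤ ∑ i ∈ s, (Real.log D - Real.log |x - y i|) := by
    refine (ENNReal.ofReal_le_ofReal_iff ?_).1 h
    exact Finset.sum_nonneg fun i hi => sub_nonneg.2 (Real.log_le_log (hpos i hi) (hx i hi))
  rw [Finset.sum_sub_distrib, Finset.sum_const, nsmul_eq_mul,
    ← Real.log_prod fun i hi => (hpos i hi).ne'] at h2
  have hP : 0 < ∏ i ∈ s, |x - y i| := Finset.prod_pos hpos
  rw [← Real.exp_log hP, ← Real.exp_log (pow_pos hD s.card), ← Real.exp_add]
  apply Real.exp_le_exp.2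
  rw [Real.log_pow]
  linarith

/-- No upper bound on the distances is needed in this direction, since truncation only enlarges the
sum. -/
lemma ofReal_le_sum_scaledKernel {D : ℝ} (hD : 0 < D) {ι : Type*} (s : Finset ι) (y : ι → ℝ)
    (x c : ℝ) (h : ∏ i ∈ s, |x - y i| ≤ D ^ s.card * Real.exp (-c)) :
    ENNReal.ofReal c ≤ ∑ i ∈ s, scaledKernel D x (y i) := by
  by_cases h0 : ∃ i ∈ s, x = y i
  · obtain ⟨i, hi, hxi⟩ := h0
    rw [ENNReal.sum_eq_top.2 ⟨i, hi, by rw [hxi, scaledKernel_self]⟩]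
    exact le_top
  push Not at h0
  have hpos : ∀ i ∈ s, 0 < |x - y i| := fun i hi => abs_pos.2 (sub_ne_zero.2 (h0 i hi))
  have hP : 0 < ∏ i ∈ s, |x - y i| := Finset.prod_pos hpos
  have h1 := Real.log_le_log hP h
  rw [Real.log_mul (by positivity) (by positivity), Real.log_exp, Real.log_pow,
    Real.log_prod fun i hi => (hpos i hi).ne'] at h1
  have e : ∑ i ∈ s, scaledKernel D x (y i)
      = ∑ i ∈ s, ENNReal.ofReal (Real.log D - Real.log |x - y i|) :=
    Finset.sum_congr rfl fun i hi => scaledKernel_of_ne D (h0 i hi)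
  calc ENNReal.ofReal c ≤ ENNReal.ofReal (∑ i ∈ s, (Real.log D - Real.log |x - y i|)) := by
        apply ENNReal.ofReal_le_ofReal
        rw [Finset.sum_sub_distrib, Finset.sum_const, nsmul_eq_mul]
        linarith
    _ ≤ ∑ i ∈ s, scaledKernel D x (y i) := by
        rw [e]
        exact Finset.le_sum_of_subadditive _ ENNReal.ofReal_zero.le
          (fun a b => ENNReal.ofReal_add_le) _ _

/-! ### Coulomb energy and capacity in terms of the scaled kernel -/

lemma logKernel_of_ne {x y : ℝ} (h : x ≠ y) : logKernel x y = ((-Real.log |x - y| : ℝ) : EReal) := by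
  have hpos : 0 < |x - y| := abs_pos.2 (sub_ne_zero.2 h)
  rw [logKernel, ENNReal.log_inv, edist_dist, Real.dist_eq, ENNReal.log_ofReal_of_pos hpos]
  simp

lemma logKernel_self (x : ℝ) : logKernel x x = ⊤ := by
  simp [logKernel]

/-- The identity log (D / r) = log (1 / r) + log D, with the negative part moved across so that no
subtraction of infinities occurs. -/
lemma scaledKernel_add_negPart {D : ℝ} (hD : 1 ≤ D) {x y : ℝ} (h : |x - y| ≤ D) :
    scaledKernel D x y + (-logKernel x y).toENNReal
      = (logKernel x y).toENNReal + ENNReal.ofReal (Real.log D) := by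
  by_cases hxy : x = y
  · subst hxy
    simp [scaledKernel_self, logKernel_self]
  · have hpos : 0 < |x - y| := abs_pos.2 (sub_ne_zero.2 hxy)
    have hl := Real.log_le_log hpos h
    have hD0 := Real.log_nonneg hD
    rw [scaledKernel_of_ne D hxy, logKernel_of_ne hxy, ← EReal.coe_neg, neg_neg,
      EReal.toENNReal_of_ne_top (EReal.coe_ne_top _), EReal.toENNReal_of_ne_top (EReal.coe_ne_top _),
      EReal.toReal_coe, EReal.toReal_coe]
    rcases le_total 0 (Real.log |x - y|) with h0 | h0
    · rw [ENNReal.ofReal_of_nonpos (neg_nonpos.2 h0), ← ENNReal.ofReal_add (by linarith) h0]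
      simp
    · rw [ENNReal.ofReal_of_nonpos h0, ← ENNReal.ofReal_add (by linarith) hD0]
      rw [add_zero]; congr 1; ring

/-- The negative part of the kernel integrates to at most `log D`, so the subtraction in
`coulombEnergy` is harmless even when the energy is infinite. -/
lemma coulombEnergy_eq {D : ℝ} (hD : 1 ≤ D) (ρ : Measure ℝ) [IsProbabilityMeasure ρ]
    {H : Set ℝ} (hH : ∀ x ∈ H, ∀ y ∈ H, |x - y| ≤ D) (hρ : ρ Hᶜ = 0) :
    coulombEnergy ρ = (scaledEnergy D ρ : EReal) - (Real.log D : ℝ) := by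
  have hae : ∀ᵐ p ∂(ρ.prod ρ), |p.1 - p.2| ≤ D := by
    have h1 : ∀ᵐ x ∂ρ, x ∈ H := by rwa [ae_iff]
    have h2 := Measure.quasiMeasurePreserving_fst (μ := ρ) (ν := ρ) |>.ae h1
    have h3 := Measure.quasiMeasurePreserving_snd (μ := ρ) (ν := ρ) |>.ae h1
    filter_upwards [h2, h3] with p hp hq using hH _ hp _ hq
  have hE : scaledEnergy D ρ = ∫⁻ p, scaledKernel D p.1 p.2 ∂(ρ.prod ρ) := by
    rw [lintegral_prod _ (measurable_scaledKernel D).aemeasurable]; rfl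
  have hneg : ∫⁻ p, (-logKernel p.1 p.2).toENNReal ∂(ρ.prod ρ) ≤ ENNReal.ofReal (Real.log D) := by
    calc ∫⁻ p, (-logKernel p.1 p.2).toENNReal ∂(ρ.prod ρ)
        ≤ ∫⁻ p, ENNReal.ofReal (Real.log D) ∂(ρ.prod ρ) := by
          apply lintegral_mono_ae
          filter_upwards [hae] with p hp
          by_cases hxy : p.1 = p.2
          · simp [hxy, logKernel_self]
          · rw [logKernel_of_ne hxy, ← EReal.coe_neg, neg_neg,
              EReal.toENNReal_of_ne_top (EReal.coe_ne_top _), EReal.toReal_coe]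
            exact ENNReal.ofReal_le_ofReal
              (Real.log_le_log (abs_pos.2 (sub_ne_zero.2 hxy)) hp)
      _ = _ := by simp
  have key : scaledEnergy D ρ + ∫⁻ p, (-logKernel p.1 p.2).toENNReal ∂(ρ.prod ρ)
      = ∫⁻ p, (logKernel p.1 p.2).toENNReal ∂(ρ.prod ρ) + ENNReal.ofReal (Real.log D) := by
    rw [hE, ← lintegral_add_left (measurable_scaledKernel D)]
    rw [lintegral_congr_ae (g := fun p => (logKernel p.1 p.2).toENNReal
      + ENNReal.ofReal (Real.log D))]
    · rw [lintegral_add_right _ measurable_const]; simp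
    · filter_upwards [hae] with p hp using scaledKernel_add_negPart hD hp
  rw [coulombEnergy]
  set P := ∫⁻ p, (logKernel p.1 p.2).toENNReal ∂(ρ.prod ρ)
  set N := ∫⁻ p, (-logKernel p.1 p.2).toENNReal ∂(ρ.prod ρ)
  have hN : N ≠ ⊤ := ne_top_of_le_ne_top ENNReal.ofReal_ne_top hneg
  have hD0 := Real.log_nonneg hD
  have hNr : (N : EReal) = (N.toReal : ℝ) := by
    rw [EReal.coe_ennreal_toReal hN]
  by_cases hP : P = ⊤
  · have : scaledEnergy D ρ = ⊤ := by
      by_contra hne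
      rw [hP, top_add] at key
      exact (ENNReal.add_ne_top.2 ⟨hne, hN⟩) key
    rw [hP, this, hNr]
    simp
  · have hS : scaledEnergy D ρ ≠ ⊤ := by
      intro h
      rw [h, top_add] at key
      exact (ENNReal.add_ne_top.2 ⟨hP, ENNReal.ofReal_ne_top⟩) key.symm
    have key' := congrArg ENNReal.toReal key
    rw [ENNReal.toReal_add hS hN, ENNReal.toReal_add hP ENNReal.ofReal_ne_top,
      ENNReal.toReal_ofReal hD0] at key'
    rw [hNr, ← EReal.coe_ennreal_toReal hP, ← EReal.coe_ennreal_toReal hS, ← EReal.coe_sub,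
      ← EReal.coe_sub]
    congr 1
    linarith

lemma logCapacity_eq {D : ℝ} (hD : 1 ≤ D) {K : Set ℝ} (hK : ∀ x ∈ K, ∀ y ∈ K, |x - y| ≤ D) :
    logCapacity K = EReal.exp ((Real.log D : ℝ) - (minEnergy D K : EReal)) := by
  rw [logCapacity]
  congr 1
  have h : (⨅ (ρ : Measure ℝ) (_ : IsProbabilityMeasure ρ) (_ : ρ Kᶜ = 0), coulombEnergy ρ)
      = (minEnergy D K : EReal) - (Real.log D : ℝ) := by
    apply le_antisymm
    · rw [EReal.le_sub_iff_add_le (Or.inl (EReal.coe_ne_bot _)) (Or.inl (EReal.coe_ne_top _))]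
      -- Replacing the left side by its `toENNReal` moves the inequality into `ℝ≥0∞`, where the
      -- infimum `minEnergy` can be tested on one measure at a time.
      refine ((le_max_right 0 _).trans_eq EReal.coe_toENNReal_eq_max.symm).trans ?_
      rw [EReal.coe_ennreal_le_coe_ennreal_iff]
      refine le_iInf₂ fun ρ hρ => le_iInf fun h0 => ?_
      rw [← EReal.toENNReal_coe (x := scaledEnergy D ρ)]
      refine EReal.toENNReal_le_toENNReal ?_
      rw [← EReal.le_sub_iff_add_le (Or.inl (EReal.coe_ne_bot _)) (Or.inl (EReal.coe_ne_top _)),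
        ← coulombEnergy_eq hD ρ hK h0]
      exact iInf₂_le_of_le ρ hρ (iInf_le _ h0)
    · refine le_iInf₂ fun ρ hρ => le_iInf fun h0 => ?_
      rw [coulombEnergy_eq hD ρ hK h0]
      refine EReal.sub_le_sub ?_ le_rfl
      exact_mod_cast iInf₂_le_of_le ρ hρ (iInf_le _ h0)
  rw [h, EReal.neg_sub (Or.inr (EReal.coe_ne_bot _)) (Or.inr (EReal.coe_ne_top _)), add_comm]
  rfl

/-! ### Weak limits, descent and compactness -/

section WeakLimits

lemma tendsto_lintegral_of_continuous_of_le {X ι : Type*} [TopologicalSpace X] [MeasurableSpace X]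
    [OpensMeasurableSpace X] {F : Filter ι} {ρs : ι → ProbabilityMeasure X}
    {σ : ProbabilityMeasure X} (h : Tendsto ρs F (𝓝 σ)) {g : X → ℝ≥0∞} (hg : Continuous g)
    {C : ℝ≥0∞} (hC : C ≠ ⊤) (hgC : ∀ x, g x ≤ C) :
    Tendsto (fun i => ∫⁻ x, g x ∂(ρs i : Measure X)) F (𝓝 (∫⁻ x, g x ∂(σ : Measure X))) := by
  have hne : ∀ x, g x ≠ ⊤ := fun x => ne_top_of_le_ne_top hC (hgC x)
  have hc : Continuous fun x => (g x).toNNReal :=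
    continuous_iff_continuousAt.2 fun x =>
      (ENNReal.tendsto_toNNReal (hne x)).comp (hg.tendsto x)
  let f : BoundedContinuousFunction X NNReal :=
    BoundedContinuousFunction.mkOfBound ⟨_, hc⟩ C.toNNReal (by
      intro x y
      have hx : (g x).toNNReal ≤ C.toNNReal := ENNReal.toNNReal_mono hC (hgC x)
      have hy : (g y).toNNReal ≤ C.toNNReal := ENNReal.toNNReal_mono hC (hgC y)
      have hx' : ((g x).toNNReal : ℝ) ≤ C.toNNReal := by exact_mod_cast hx
      have hy' : ((g y).toNNReal : ℝ) ≤ C.toNNReal := by exact_mod_cast hy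
      rw [NNReal.dist_eq, abs_le]
      constructor
      · have := (g x).toNNReal.coe_nonneg
        simp only [ContinuousMap.coe_mk]; linarith
      · have := (g y).toNNReal.coe_nonneg
        simp only [ContinuousMap.coe_mk]; linarith)
  have e : ∀ x, (f x : ℝ≥0∞) = g x := fun x => ENNReal.coe_toNNReal (hne x)
  have := ProbabilityMeasure.tendsto_iff_forall_lintegral_tendsto.1 h f
  simpa only [e] using this

/-- The principle of descent. -/
lemma scaledPotential_le_of_tendsto {ι : Type*} {F : Filter ι} [F.NeBot]
    {ρs : ι → ProbabilityMeasure ℝ} {σ : ProbabilityMeasure ℝ} (h : Tendsto ρs F (𝓝 σ))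
    {D x : ℝ} {c : ℝ≥0∞} (hc : ∀ᶠ i in F, scaledPotential D (ρs i) x ≤ c) :
    scaledPotential D σ x ≤ c := by
  -- Weak convergence passes through each bounded continuous truncation; monotone convergence then
  -- recovers the full kernel.
  simp_rw [scaledPotential, ← iSup_truncKernel]
  rw [lintegral_iSup (measurable_truncKernel_right D · x)
    (fun m n hmn y => truncKernel_mono D x y hmn)]
  refine iSup_le fun n => ?_
  refine le_of_tendsto (tendsto_lintegral_of_continuous_of_le h
    (g := truncKernel D n x) ((continuous_truncKernel D n).comp (Continuous.prodMk_right x))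
    ENNReal.ofReal_ne_top (truncKernel_le D n x)) ?_
  filter_upwards [hc] with i hi
  exact (lintegral_mono fun y => truncKernel_le_scaledKernel D n x y).trans hi

lemma scaledEnergy_eq_lintegral_prod (D : ℝ) (ρ : Measure ℝ) [SFinite ρ] :
    scaledEnergy D ρ = ∫⁻ p, scaledKernel D p.1 p.2 ∂(ρ.prod ρ) := by
  rw [lintegral_prod _ (measurable_scaledKernel D).aemeasurable]; rfl

/-- The hypothesis involves truncated energies because empirical measures have infinite energy. The
errors `δ n` leave room for the diagonal, whose truncated contribution vanishes in the limit. -/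
lemma scaledEnergy_le_of_tendsto {ι : Type*} {F : Filter ι} [F.NeBot]
    {ρs : ι → ProbabilityMeasure ℝ} {σ : ProbabilityMeasure ℝ} (h : Tendsto ρs F (𝓝 σ))
    {D : ℝ} {c : ℝ≥0∞} {δ : ℕ → ι → ℝ≥0∞} (hδ : ∀ n, Tendsto (δ n) F (𝓝 0))
    (hc : ∀ n, ∀ᶠ i in F,
      ∫⁻ p, truncKernel D n p.1 p.2 ∂((ρs i : Measure ℝ).prod (ρs i)) ≤ c + δ n i) :
    scaledEnergy D σ ≤ c := by
  rw [scaledEnergy_eq_lintegral_prod]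
  simp_rw [← iSup_truncKernel]
  rw [lintegral_iSup (measurable_truncKernel D)
    (fun m n hmn p => truncKernel_mono D p.1 p.2 hmn)]
  refine iSup_le fun n => ?_
  have h2 : Tendsto (fun i => (ρs i).prod (ρs i)) F (𝓝 (σ.prod σ)) :=
    (ProbabilityMeasure.continuous_prod.tendsto (σ, σ)).comp (h.prodMk_nhds h)
  have h3 := tendsto_lintegral_of_continuous_of_le h2 (continuous_truncKernel D n)
    ENNReal.ofReal_ne_top (fun p => truncKernel_le D n p.1 p.2)
  have h4 : Tendsto (fun i => c + δ n i) F (𝓝 c) := by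
    simpa using tendsto_const_nhds.add (hδ n)
  exact le_of_tendsto_of_tendsto h3 h4 (hc n)

/-- The uniform probability measure on `n + 1` points, counted with multiplicity. -/
noncomputable def empirical {n : ℕ} (y : Fin (n + 1) → ℝ) : ProbabilityMeasure ℝ :=
  ⟨((n : ℝ≥0∞) + 1)⁻¹ • ∑ i, Measure.dirac (y i), ⟨by
    simp only [Measure.smul_apply, Measure.finsetSum_apply, smul_eq_mul, measure_univ,
      Finset.sum_const, Finset.card_univ, Fintype.card_fin, nsmul_eq_mul, mul_one]
    push_cast
    exact ENNReal.inv_mul_cancel (by simp) (by finiteness)⟩⟩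

lemma coe_empirical {n : ℕ} (y : Fin (n + 1) → ℝ) :
    (empirical y : Measure ℝ) = ((n : ℝ≥0∞) + 1)⁻¹ • ∑ i, Measure.dirac (y i) := rfl

lemma lintegral_empirical {n : ℕ} (y : Fin (n + 1) → ℝ) (f : ℝ → ℝ≥0∞) :
    ∫⁻ x, f x ∂(empirical y : Measure ℝ) = ((n : ℝ≥0∞) + 1)⁻¹ * ∑ i, f (y i) := by
  simp [coe_empirical, lintegral_smul_measure, lintegral_finsetSum_measure]

lemma integral_empirical {n : ℕ} (y : Fin (n + 1) → ℝ) (f : ℝ → ℝ) :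
    ∫ x, f x ∂(empirical y : Measure ℝ) = ((n : ℝ) + 1)⁻¹ * ∑ i, f (y i) := by
  rw [coe_empirical, integral_smul_measure, integral_finsetSum_measure]
  · have : ((n : ℝ≥0∞) + 1).toReal = (n : ℝ) + 1 := by
      rw [ENNReal.toReal_add (by finiteness) (by finiteness)]; simp
    simp [this]
  · intro i _
    exact integrable_dirac (by finiteness)

lemma empirical_compl_eq_zero {n : ℕ} {y : Fin (n + 1) → ℝ} {K : Set ℝ} (h : ∀ i, y i ∈ K) :
    (empirical y : Measure ℝ) Kᶜ = 0 := by
  simp [coe_empirical, Measure.dirac_apply, h]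

/-- Prokhorov's theorem. Limits along ultrafilters spare the extraction of subsequences. -/
lemma exists_tendsto_of_compl_eq_zero {K : Set ℝ} (hK : IsCompact K) {ι : Type*}
    (U : Ultrafilter ι) {ρs : ι → ProbabilityMeasure ℝ} (h : ∀ i, (ρs i : Measure ℝ) Kᶜ = 0) :
    ∃ σ : ProbabilityMeasure ℝ, (σ : Measure ℝ) Kᶜ = 0 ∧ Tendsto ρs U (𝓝 σ) := by
  have hc := isCompact_setOfPred_probabilityMeasure_mass_eq_compl_isCompact_le
    (E := ℝ) (u := fun _ => 0) (K := fun _ => K) tendsto_const_nhds (fun _ => hK)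
    (Or.inl inferInstance)
  obtain ⟨σ, hσ, hlim⟩ := hc.ultrafilter_le_nhds (U.map ρs) (by
    rw [le_principal_iff]
    refine mem_map.2 (Filter.univ_mem' fun i => ?_)
    intro n
    simp [ProbabilityMeasure.coeFn_def, h i])
  refine ⟨σ, ?_, hlim⟩
  have := hσ 0
  simpa [ProbabilityMeasure.coeFn_def, ENNReal.toNNReal_eq_zero_iff] using this

end WeakLimits

/-! ### Frostman's theorem and the maximum principle -/

section Frostman

/-- **Frostman's theorem**, lower bound. -/
lemma minEnergy_le_scaledPotential_ae {D : ℝ} {K : Set ℝ} {τ ρ : Measure ℝ}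
    [IsProbabilityMeasure τ] [IsProbabilityMeasure ρ] (hτK : τ Kᶜ = 0)
    (hτ : scaledEnergy D τ = minEnergy D K) (hfin : minEnergy D K ≠ ⊤)
    (hρK : ρ Kᶜ = 0) (hρ : scaledEnergy D ρ ≠ ⊤) :
    ∀ᵐ x ∂ρ, minEnergy D K ≤ scaledPotential D τ x := by
  set w := minEnergy D K with hw
  -- If the potential of `τ` were below `w` on a set `A` charged by `ρ`, moving a little mass from
  -- `τ` to the normalized restriction `ρ'` of `ρ` to `A` would lower the energy: the derivative at
  -- `t = 0` is 2 (u - w) < 0. Finite energy of `ρ` keeps the quadratic term finite.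
  by_contra hcon
  set A := {x | scaledPotential D τ x < w} with hA
  have hAm : MeasurableSet A := measurableSet_lt (measurable_scaledPotential D τ) measurable_const
  have hA0 : ρ A ≠ 0 := by
    intro h0
    apply hcon
    rw [ae_iff]
    simpa [hA] using h0
  have hAt : (ρ A)⁻¹ ≠ ⊤ := ENNReal.inv_ne_top.2 hA0
  let ρ' : Measure ℝ := (ρ A)⁻¹ • ρ.restrict A
  have hρ'p : IsProbabilityMeasure ρ' :=
    ⟨by simp [ρ', ENNReal.inv_mul_cancel hA0 (measure_ne_top _ _)]⟩
  have hρ'K : ρ' Kᶜ = 0 := by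
    simp only [ρ', Measure.smul_apply, smul_eq_mul, mul_eq_zero]
    exact Or.inr (Measure.absolutelyContinuous_of_le Measure.restrict_le_self hρK)
  have hρ'e : scaledEnergy D ρ' ≠ ⊤ := by
    have : scaledEnergy D ρ' ≤ (ρ A)⁻¹ * ((ρ A)⁻¹ * scaledEnergy D ρ) := by
      simp only [scaledEnergy, scaledPotential, ρ', lintegral_smul_measure, smul_eq_mul]
      gcongr
      rw [← lintegral_const_mul _ (show Measurable fun x => ∫⁻ y, scaledKernel D x y ∂ρ from
        measurable_scaledPotential D ρ)]
      refine (setLIntegral_le_lintegral _ _).trans ?_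
      refine lintegral_mono fun x => ?_
      gcongr
      exact Measure.restrict_le_self
    exact ne_top_of_le_ne_top (by finiteness) this
  set u := ∫⁻ x, scaledPotential D τ x ∂ρ' with hu
  have hle : ∀ᵐ x ∂ρ', scaledPotential D τ x < w := by
    have : ∀ᵐ x ∂(ρ.restrict A), scaledPotential D τ x < w := ae_restrict_mem hAm
    exact Measure.ae_smul_measure this _
  have huw : u < w := by
    have hfi : ∫⁻ x, scaledPotential D τ x ∂ρ' ≠ ⊤ := by
      refine ne_top_of_le_ne_top hfin ?_
      calc ∫⁻ x, scaledPotential D τ x ∂ρ' ≤ ∫⁻ x, w ∂ρ' :=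
            lintegral_mono_ae (hle.mono fun x hx => hx.le)
        _ = w := by simp
    have := lintegral_strict_mono (IsProbabilityMeasure.ne_zero ρ') aemeasurable_const hfi hle
    simpa using this
  set e := scaledEnergy D ρ' with he
  have huT : u ≠ ⊤ := huw.ne_top
  have hmix : ∀ t : ℝ, 0 ≤ t → t ≤ 1 →
      w.toReal ≤ (1 - t) ^ 2 * w.toReal + 2 * t * (1 - t) * u.toReal + t ^ 2 * e.toReal := by
    intro t h0 h1
    have h1' : 0 ≤ 1 - t := by linarith
    let η : Measure ℝ := ENNReal.ofReal (1 - t) • τ + ENNReal.ofReal t • ρ'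
    have hηp : IsProbabilityMeasure η := ⟨by
      simp [η, ← ENNReal.ofReal_add h1' h0]⟩
    have hηK : η Kᶜ = 0 := by simp [η, hτK, hρ'K]
    have hmin : w ≤ scaledEnergy D η := iInf₂_le_of_le η hηp (iInf_le _ hηK)
    have hη : scaledEnergy D η = ENNReal.ofReal (1 - t) * (ENNReal.ofReal (1 - t) * w)
        + ENNReal.ofReal (1 - t) * (ENNReal.ofReal t * u)
        + (ENNReal.ofReal t * (ENNReal.ofReal (1 - t) * u)
        + ENNReal.ofReal t * (ENNReal.ofReal t * e)) := by
      have hpot : ∀ x, scaledPotential D η x = ENNReal.ofReal (1 - t) * scaledPotential D τ x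
          + ENNReal.ofReal t * scaledPotential D ρ' x := by
        intro x
        simp [scaledPotential, η, lintegral_add_measure, lintegral_smul_measure]
      have hm1 := measurable_scaledPotential D τ
      have hm2 := measurable_scaledPotential D ρ'
      have hlin : ∀ κ : Measure ℝ, ∫⁻ x, scaledPotential D η x ∂κ
          = ENNReal.ofReal (1 - t) * ∫⁻ x, scaledPotential D τ x ∂κ
          + ENNReal.ofReal t * ∫⁻ x, scaledPotential D ρ' x ∂κ := by
        intro κ
        simp_rw [hpot]
        rw [lintegral_add_left (hm1.const_mul _), lintegral_const_mul _ hm1,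
          lintegral_const_mul _ hm2]
      rw [scaledEnergy]
      conv_lhs => rw [show η = ENNReal.ofReal (1 - t) • τ + ENNReal.ofReal t • ρ' from rfl]
      rw [lintegral_add_measure, lintegral_smul_measure, lintegral_smul_measure]
      change ENNReal.ofReal (1 - t) * ∫⁻ x, scaledPotential D η x ∂τ
        + ENNReal.ofReal t * ∫⁻ x, scaledPotential D η x ∂ρ' = _
      rw [hlin, hlin, lintegral_scaledPotential_comm D ρ' τ, ← hu]
      change ENNReal.ofReal (1 - t) * (ENNReal.ofReal (1 - t) * scaledEnergy D τ + _)
        + ENNReal.ofReal t * (_ + ENNReal.ofReal t * scaledEnergy D ρ') = _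
      rw [hτ, ← he, mul_add, mul_add]
    rw [hη] at hmin
    have := ENNReal.toReal_mono (by finiteness) hmin
    rw [ENNReal.toReal_add (by finiteness) (by finiteness),
      ENNReal.toReal_add (by finiteness) (by finiteness),
      ENNReal.toReal_add (by finiteness) (by finiteness)] at this
    simp only [ENNReal.toReal_mul, ENNReal.toReal_ofReal h0, ENNReal.toReal_ofReal h1'] at this
    linarith
  have hlt : u.toReal < w.toReal := ENNReal.toReal_strict_mono hfin huw
  have hu0 : 0 ≤ u.toReal := ENNReal.toReal_nonneg
  have he0 : 0 ≤ e.toReal := ENNReal.toReal_nonneg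
  set W := w.toReal
  set V := u.toReal
  set E := e.toReal
  have hden : 0 < W + E + 1 := by linarith
  -- For this `t` the quadratic term t² (W - 2V + E) is at most t (W - V), half of the linear gain
  -- 2t (W - V).
  have ht0 : 0 < (W - V) / (W + E + 1) := div_pos (by linarith) hden
  have ht1 : (W - V) / (W + E + 1) ≤ 1 := by rw [div_le_one hden]; linarith
  have h := hmix _ ht0.le ht1
  set t := (W - V) / (W + E + 1) with ht
  have h2 : t * (W + E + 1) = W - V := div_mul_cancel₀ _ hden.ne'
  have h3 : 0 ≤ t * (t * (W - 2 * V + E) - 2 * (W - V)) := by linarith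
  have h4 : t * (W - 2 * V + E) ≤ W - V := by
    rw [← h2]
    exact mul_le_mul_of_nonneg_left (by linarith) ht0.le
  have h5 := nonneg_of_mul_nonneg_right h3 ht0
  linarith

/-- **Frostman's theorem**, upper bound on the support. -/
lemma scaledPotential_le_minEnergy_of_mem_support {D : ℝ} {K : Set ℝ} {τ : Measure ℝ}
    [IsProbabilityMeasure τ] (hτK : τ Kᶜ = 0)
    (hτ : scaledEnergy D τ = minEnergy D K) (hfin : minEnergy D K ≠ ⊤) {x : ℝ}
    (hx : x ∈ τ.support) : scaledPotential D τ x ≤ minEnergy D K := by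
  -- Applied to `τ` itself, the lower bound holds almost everywhere, while the mean of the potential
  -- equals the bound; so there is equality almost everywhere. Lower semicontinuity carries the
  -- inequality to the whole support.
  have h1 := minEnergy_le_scaledPotential_ae hτK hτ hfin hτK (hτ ▸ hfin)
  have h2 := ae_eq_of_ae_le_of_lintegral_le h1 (by simpa using hfin)
    (measurable_scaledPotential D τ).aemeasurable (by simpa [scaledEnergy] using hτ.le)
  have hcl : IsClosed {x | scaledPotential D τ x ≤ minEnergy D K} :=
    (lowerSemicontinuous_scaledPotential D τ).isClosed_preimage _
  refine Measure.support_subset_of_isClosed hcl ?_ hx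
  filter_upwards [h2] with y hy using hy.ge

lemma scaledKernel_le_of_abs_le {D x y z : ℝ} (h : |z - y| ≤ |x - y|) :
    scaledKernel D x y ≤ scaledKernel D z y := by
  by_cases hzy : z = y
  · rw [hzy, scaledKernel_self]; exact le_top
  have hpos : 0 < |z - y| := abs_pos.2 (sub_ne_zero.2 hzy)
  have hxy : x ≠ y := by
    rintro rfl
    simp at h
    exact hzy (sub_eq_zero.1 h)
  rw [scaledKernel_of_ne D hzy, scaledKernel_of_ne D hxy]
  exact ENNReal.ofReal_le_ofReal (sub_le_sub_left (Real.log_le_log hpos h) _)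

/-- Concavity of the logarithm: on an interval whose interior avoids `y`, the kernel is convex in
its first variable, and truncation at `0` preserves this. -/
lemma scaledKernel_le_convexComb {D α β x y : ℝ} (hαx : α < x) (hxβ : x < β)
    (hy : y ≤ α ∨ β ≤ y) :
    scaledKernel D x y ≤ ENNReal.ofReal ((β - x) / (β - α)) * scaledKernel D α y
      + ENNReal.ofReal ((x - α) / (β - α)) * scaledKernel D β y := by
  have hαβ : 0 < β - α := by linarith
  have ht : 0 < (β - x) / (β - α) := div_pos (by linarith) hαβ
  have hs : 0 < (x - α) / (β - α) := div_pos (by linarith) hαβ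
  have hts : (β - x) / (β - α) + (x - α) / (β - α) = 1 := by field_simp; ring
  by_cases h1 : α = y
  · rw [h1, scaledKernel_self, ← h1, ENNReal.mul_top (by simpa using ht)]
    simp
  by_cases h2 : β = y
  · rw [h2, scaledKernel_self, ← h2, ENNReal.mul_top (by simpa using hs)]
    simp
  have h3 : x ≠ y := by rcases hy with h | h <;> rintro rfl <;> linarith
  have p1 : 0 < |α - y| := abs_pos.2 (sub_ne_zero.2 h1)
  have p2 : 0 < |β - y| := abs_pos.2 (sub_ne_zero.2 h2)
  have hcomb : (β - x) / (β - α) * |α - y| + (x - α) / (β - α) * |β - y| = |x - y| := by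
    rcases hy with h | h
    · rw [abs_of_nonneg (by linarith), abs_of_nonneg (by linarith), abs_of_nonneg (by linarith)]
      field_simp; ring
    · rw [abs_of_nonpos (by linarith), abs_of_nonpos (by linarith), abs_of_nonpos (by linarith)]
      field_simp; ring
  have hlog := strictConcaveOn_log_Ioi.concaveOn.2 (mem_Ioi.2 p1) (mem_Ioi.2 p2) ht.le hs.le hts
  simp only [smul_eq_mul] at hlog
  rw [hcomb] at hlog
  rw [scaledKernel_of_ne D h1, scaledKernel_of_ne D h2, scaledKernel_of_ne D h3,
    ← ENNReal.ofReal_mul ht.le, ← ENNReal.ofReal_mul hs.le]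
  refine le_trans (ENNReal.ofReal_le_ofReal ?_) ENNReal.ofReal_add_le
  have : Real.log D = (β - x) / (β - α) * Real.log D + (x - α) / (β - α) * Real.log D := by
    rw [← add_mul, hts, one_mul]
  linarith

/-- The **maximum principle** for logarithmic potentials on the line. -/
lemma scaledPotential_le_of_le_on_closed {D : ℝ} {τ : Measure ℝ} [IsProbabilityMeasure τ]
    {S : Set ℝ} (hS : IsClosed S) (hτS : τ Sᶜ = 0) {c : ℝ≥0∞}
    (hc : ∀ x ∈ S, scaledPotential D τ x ≤ c) (x : ℝ) : scaledPotential D τ x ≤ c := by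
  by_cases hxS : x ∈ S
  · exact hc x hxS
  have hae : ∀ᵐ y ∂τ, y ∈ S := by rwa [ae_iff]
  have hne : S.Nonempty := by
    obtain ⟨y, hy⟩ := hae.exists
    exact ⟨y, hy⟩
  -- In a bounded gap of `S` the potential is convex, so it is controlled by the two end points.
  -- Beyond an extreme point of `S`, moving back to that point brings `x` closer to all the mass.
  by_cases hl : (S ∩ Iic x).Nonempty
  · have hα := (hS.inter isClosed_Iic).csSup_mem hl (bddAbove_Iic.mono inter_subset_right)
    set α := sSup (S ∩ Iic x)
    have hα' : ∀ y ∈ S, y ≤ x → y ≤ α := fun y hy hyx =>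
      le_csSup (bddAbove_Iic.mono inter_subset_right) ⟨hy, hyx⟩
    have hαx : α < x := lt_of_le_of_ne hα.2 fun h => hxS (h ▸ hα.1)
    by_cases hr : (S ∩ Ici x).Nonempty
    · have hβ := (hS.inter isClosed_Ici).csInf_mem hr (bddBelow_Ici.mono inter_subset_right)
      set β := sInf (S ∩ Ici x)
      have hβ' : ∀ y ∈ S, x ≤ y → β ≤ y := fun y hy hyx =>
        csInf_le (bddBelow_Ici.mono inter_subset_right) ⟨hy, hyx⟩
      have hxβ : x < β := lt_of_le_of_ne hβ.2 fun h => hxS (h ▸ hβ.1)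
      have hαβ : 0 < β - α := by linarith
      calc scaledPotential D τ x
          ≤ ∫⁻ y, (ENNReal.ofReal ((β - x) / (β - α)) * scaledKernel D α y
            + ENNReal.ofReal ((x - α) / (β - α)) * scaledKernel D β y) ∂τ := by
            refine lintegral_mono_ae ?_
            filter_upwards [hae] with y hy
            exact scaledKernel_le_convexComb hαx hxβ
              ((le_total y x).imp (hα' y hy) (hβ' y hy))
        _ = ENNReal.ofReal ((β - x) / (β - α)) * scaledPotential D τ α
            + ENNReal.ofReal ((x - α) / (β - α)) * scaledPotential D τ β := by
            rw [lintegral_add_left ((measurable_scaledKernel_right D α).const_mul _),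
              lintegral_const_mul _ (measurable_scaledKernel_right D α),
              lintegral_const_mul _ (measurable_scaledKernel_right D β)]
            rfl
        _ ≤ ENNReal.ofReal ((β - x) / (β - α)) * c + ENNReal.ofReal ((x - α) / (β - α)) * c := by
            gcongr
            · exact hc α hα.1
            · exact hc β hβ.1
        _ = c := by
            rw [← add_mul, ← ENNReal.ofReal_add (div_nonneg (by linarith) hαβ.le)
              (div_nonneg (by linarith) hαβ.le), ← add_div]
            rw [show β - x + (x - α) = β - α by ring, div_self hαβ.ne']
            simp
    · refine le_trans (lintegral_mono_ae ?_) (hc α hα.1)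
      filter_upwards [hae] with y hy
      have hyx : y ≤ x := by
        by_contra h
        exact hr ⟨y, hy, (not_le.1 h).le⟩
      have := hα' y hy hyx
      apply scaledKernel_le_of_abs_le
      rw [abs_of_nonneg (by linarith), abs_of_nonneg (by linarith)]
      linarith
  · have hr : (S ∩ Ici x).Nonempty := by
      obtain ⟨y, hy⟩ := hne
      refine ⟨y, hy, ?_⟩
      by_contra h
      exact hl ⟨y, hy, (not_le.1 (show ¬ x ≤ y from h)).le⟩
    have hβ := (hS.inter isClosed_Ici).csInf_mem hr (bddBelow_Ici.mono inter_subset_right)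
    set β := sInf (S ∩ Ici x)
    have hβ' : ∀ y ∈ S, x ≤ y → β ≤ y := fun y hy hyx =>
      csInf_le (bddBelow_Ici.mono inter_subset_right) ⟨hy, hyx⟩
    have hxβ : x ≤ β := hβ.2
    refine le_trans (lintegral_mono_ae ?_) (hc β hβ.1)
    filter_upwards [hae] with y hy
    have hyx : x ≤ y := by
      by_contra h
      exact hl ⟨y, hy, (not_le.1 h).le⟩
    have := hβ' y hy hyx
    apply scaledKernel_le_of_abs_le
    rw [abs_of_nonpos (by linarith), abs_of_nonpos (by linarith)]
    linarith

/-- The equilibrium potential is at most the least energy everywhere. -/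
lemma scaledPotential_le_minEnergy {D : ℝ} {K : Set ℝ} {τ : Measure ℝ}
    [IsProbabilityMeasure τ] (hτK : τ Kᶜ = 0)
    (hτ : scaledEnergy D τ = minEnergy D K) (hfin : minEnergy D K ≠ ⊤) (x : ℝ) :
    scaledPotential D τ x ≤ minEnergy D K :=
  scaledPotential_le_of_le_on_closed Measure.isClosed_support Measure.measure_compl_support
    (fun _ h => scaledPotential_le_minEnergy_of_mem_support hτK hτ hfin h) x

end Frostman

/-! ### Fekete points -/

section Fekete

/-- Isolates the interactions of one point, which are the only ones that change when this point is
moved. -/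
lemma sum_offDiag_eq {ι M : Type*} [Fintype ι] [DecidableEq ι] [AddCommMonoid M]
    (f : ι → ι → M) (a : ι) :
    ∑ i, ∑ j ∈ Finset.univ.erase i, f i j
      = ∑ i ∈ Finset.univ.erase a, (f a i + f i a)
        + ∑ i ∈ Finset.univ.erase a, ∑ j ∈ (Finset.univ.erase a).erase i, f i j := by
  have h : ∀ i ∈ Finset.univ.erase a, ∑ j ∈ Finset.univ.erase i, f i j
      = f i a + ∑ j ∈ (Finset.univ.erase a).erase i, f i j := by
    intro i hi
    have ha : a ∈ Finset.univ.erase i := by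
      simpa [eq_comm] using (Finset.mem_erase.1 hi).1
    rw [← Finset.add_sum_erase _ (f i) ha, Finset.erase_right_comm]
  rw [← Finset.add_sum_erase _ (fun i => ∑ j ∈ Finset.univ.erase i, f i j) (Finset.mem_univ a),
    Finset.sum_congr rfl h, Finset.sum_add_distrib, Finset.sum_add_distrib, add_assoc]

/-- The discrete energy of a tuple of points. -/
noncomputable def discreteEnergy (D : ℝ) {n : ℕ} (x : Fin (n + 1) → ℝ) : ℝ≥0∞ :=
  ∑ i, ∑ j ∈ Finset.univ.erase i, scaledKernel D (x i) (x j)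

lemma lowerSemicontinuous_discreteEnergy (D : ℝ) (n : ℕ) :
    LowerSemicontinuous (discreteEnergy D (n := n)) := by
  refine lowerSemicontinuous_sum fun i _ => lowerSemicontinuous_sum fun j _ => ?_
  have hc : Continuous fun x : Fin (n + 1) → ℝ => (x i, x j) := by fun_prop
  intro x c hx
  exact (hc.tendsto x).eventually (lowerSemicontinuous_scaledKernel D (x i, x j) c hx)

/-- Distinct coordinates are independent, so each of the n (n + 1) ordered pairs contributes the
energy of `ρ`. -/
lemma lintegral_discreteEnergy (D : ℝ) (n : ℕ) (ρ : Measure ℝ) [IsProbabilityMeasure ρ] :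
    ∫⁻ x, discreteEnergy D x ∂(Measure.pi fun _ : Fin (n + 1) => ρ)
      = ((n : ℝ≥0∞) + 1) * (n * scaledEnergy D ρ) := by
  have hm : ∀ i j : Fin (n + 1),
      Measurable fun x : Fin (n + 1) → ℝ => scaledKernel D (x i) (x j) := fun i j =>
    (measurable_scaledKernel D).comp (f := fun x : Fin (n + 1) → ℝ => (x i, x j)) (by fun_prop)
  simp only [discreteEnergy]
  rw [lintegral_finsetSum _ fun i _ => Finset.measurable_sum _ fun j _ => hm i j]
  have h : ∀ i : Fin (n + 1), ∀ j ∈ Finset.univ.erase i,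
      ∫⁻ x, scaledKernel D (x i) (x j) ∂(Measure.pi fun _ : Fin (n + 1) => ρ)
        = scaledEnergy D ρ := by
    intro i j hj
    have hij : i ≠ j := (Finset.ne_of_mem_erase hj).symm
    have hind := (ProbabilityTheory.iIndepFun_pi (μ := fun _ : Fin (n + 1) => ρ)
      (X := fun _ => (id : ℝ → ℝ)) (fun _ => aemeasurable_id)).indepFun hij
    simp only [id] at hind
    rw [ProbabilityTheory.indepFun_iff_map_prod_eq_prod_map_map (measurable_pi_apply i).aemeasurable
      (measurable_pi_apply j).aemeasurable] at hind
    have e : ∀ k : Fin (n + 1),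
        Measure.map (fun x : Fin (n + 1) → ℝ => x k) (Measure.pi fun _ => ρ) = ρ := fun k =>
      (measurePreserving_eval (fun _ : Fin (n + 1) => ρ) k).map_eq
    rw [e, e] at hind
    rw [scaledEnergy_eq_lintegral_prod, ← hind,
      lintegral_map (measurable_scaledKernel D) (by fun_prop)]
  have h2 : ∀ i ∈ (Finset.univ : Finset (Fin (n + 1))),
      ∫⁻ x, ∑ j ∈ Finset.univ.erase i, scaledKernel D (x i) (x j)
        ∂(Measure.pi fun _ : Fin (n + 1) => ρ) = n * scaledEnergy D ρ := by
    intro i _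
    rw [lintegral_finsetSum _ fun j _ => hm i j, Finset.sum_congr rfl (h i)]
    simp
  rw [Finset.sum_congr rfl h2]
  simp

lemma exists_minimizer_discreteEnergy (D : ℝ) {K : Set ℝ} (hK : IsCompact K) (hne : K.Nonempty)
    (n : ℕ) : ∃ x : Fin (n + 1) → ℝ, (∀ i, x i ∈ K) ∧
      ∀ z : Fin (n + 1) → ℝ, (∀ i, z i ∈ K) → discreteEnergy D x ≤ discreteEnergy D z := by
  obtain ⟨k, hk⟩ := hne
  obtain ⟨x, hx, hmin⟩ := LowerSemicontinuousOn.exists_isMinOn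
    (s := Set.pi univ fun _ : Fin (n + 1) => K) (f := discreteEnergy D)
    ⟨fun _ => k, fun _ _ => hk⟩ (isCompact_univ_pi fun _ => hK)
    ((lowerSemicontinuous_discreteEnergy D n).lowerSemicontinuousOn _)
  exact ⟨x, fun i => hx i (mem_univ i), fun z hz => hmin (fun i _ => hz i)⟩

/-- A minimum is at most the average over independent random points. -/
lemma discreteEnergy_le_of_minimizer {D : ℝ} {K : Set ℝ} {n : ℕ} {x : Fin (n + 1) → ℝ}
    (hx : ∀ z : Fin (n + 1) → ℝ, (∀ i, z i ∈ K) → discreteEnergy D x ≤ discreteEnergy D z)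
    (ρ : Measure ℝ) [IsProbabilityMeasure ρ] (hρ : ρ Kᶜ = 0) :
    discreteEnergy D x ≤ ((n : ℝ≥0∞) + 1) * (n * scaledEnergy D ρ) := by
  rw [← lintegral_discreteEnergy]
  have hae : ∀ᵐ z ∂(Measure.pi fun _ : Fin (n + 1) => ρ), ∀ i, z i ∈ K := by
    rw [ae_all_iff]
    intro i
    have : ∀ᵐ y ∂ρ, y ∈ K := by rwa [ae_iff]
    exact (Measure.quasiMeasurePreserving_eval (fun _ : Fin (n + 1) => ρ) i).ae this
  calc discreteEnergy D x = ∫⁻ _, discreteEnergy D x ∂(Measure.pi fun _ : Fin (n + 1) => ρ) := by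
        simp
    _ ≤ _ := lintegral_mono_ae (hae.mono fun z hz => hx z hz)

/-- Moving the point `x a` to `z` does not lower the energy. Cancelling the interactions of the
other points, which needs finiteness, bounds those of `x a` by those of `z`; then sum over `a`. -/
lemma discreteEnergy_le_sum_scaledKernel {D : ℝ} {K : Set ℝ} {n : ℕ} {x : Fin (n + 1) → ℝ}
    (hxK : ∀ i, x i ∈ K) (hfin : discreteEnergy D x ≠ ⊤)
    (hx : ∀ z : Fin (n + 1) → ℝ, (∀ i, z i ∈ K) → discreteEnergy D x ≤ discreteEnergy D z)
    {z : ℝ} (hz : z ∈ K) :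
    discreteEnergy D x ≤ ((n : ℝ≥0∞) + 1) * ∑ i, scaledKernel D z (x i) := by
  have key : ∀ a, ∑ i ∈ Finset.univ.erase a, scaledKernel D (x a) (x i)
      ≤ ∑ i, scaledKernel D z (x i) := by
    intro a
    have h1 := hx (Function.update x a z) (fun i => by
      by_cases h : i = a
      · subst h; simpa using hz
      · simpa [Function.update_of_ne h] using hxK i)
    simp only [discreteEnergy] at h1
    rw [sum_offDiag_eq (fun i j => scaledKernel D (x i) (x j)) a,
      sum_offDiag_eq (fun i j => scaledKernel D (Function.update x a z i)
        (Function.update x a z j)) a] at h1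
    have hR : ∑ i ∈ Finset.univ.erase a, ∑ j ∈ (Finset.univ.erase a).erase i,
        scaledKernel D (Function.update x a z i) (Function.update x a z j)
        = ∑ i ∈ Finset.univ.erase a, ∑ j ∈ (Finset.univ.erase a).erase i,
          scaledKernel D (x i) (x j) := by
      refine Finset.sum_congr rfl fun i hi => Finset.sum_congr rfl fun j hj => ?_
      rw [Function.update_of_ne (Finset.ne_of_mem_erase hi),
        Function.update_of_ne (Finset.ne_of_mem_erase (Finset.mem_of_mem_erase hj))]
    have hS : ∑ i ∈ Finset.univ.erase a, (scaledKernel D (Function.update x a z a)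
          (Function.update x a z i)
          + scaledKernel D (Function.update x a z i) (Function.update x a z a))
        = 2 * ∑ i ∈ Finset.univ.erase a, scaledKernel D z (x i) := by
      rw [Finset.mul_sum]
      refine Finset.sum_congr rfl fun i hi => ?_
      rw [Function.update_of_ne (Finset.ne_of_mem_erase hi), Function.update_self,
        scaledKernel_comm D (x i) z, two_mul]
    have hT : ∑ i ∈ Finset.univ.erase a, (scaledKernel D (x a) (x i) + scaledKernel D (x i) (x a))
        = 2 * ∑ i ∈ Finset.univ.erase a, scaledKernel D (x a) (x i) := by
      rw [Finset.mul_sum]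
      refine Finset.sum_congr rfl fun i _ => ?_
      rw [scaledKernel_comm D (x i), two_mul]
    rw [hR, hS, hT] at h1
    have hRfin : ∑ i ∈ Finset.univ.erase a, ∑ j ∈ (Finset.univ.erase a).erase i,
        scaledKernel D (x i) (x j) ≠ ⊤ := by
      refine ne_top_of_le_ne_top hfin ?_
      rw [discreteEnergy, sum_offDiag_eq (fun i j => scaledKernel D (x i) (x j)) a]
      exact le_add_self
    have h2 := (ENNReal.add_le_add_iff_right hRfin).1 h1
    have h3 := (ENNReal.mul_le_mul_iff_right (by simp) (by simp)).1 h2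
    exact h3.trans (Finset.sum_le_sum_of_subset (Finset.erase_subset _ _))
  calc discreteEnergy D x ≤ ∑ _a : Fin (n + 1), ∑ i, scaledKernel D z (x i) :=
        Finset.sum_le_sum fun a _ => key a
    _ = _ := by simp

/-- The second term is the price of the n + 1 diagonal pairs, each of weight (n + 1)⁻² and at most
the bound of the truncated kernel. -/
lemma lintegral_truncKernel_empirical_le (D : ℝ) (m : ℕ) {n : ℕ} (x : Fin (n + 1) → ℝ) {c : ℝ≥0∞}
    (hc : discreteEnergy D x ≤ ((n : ℝ≥0∞) + 1) * (((n : ℝ≥0∞) + 1) * c)) :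
    ∫⁻ p, truncKernel D m p.1 p.2 ∂((empirical x : Measure ℝ).prod (empirical x))
      ≤ c + ENNReal.ofReal (Real.log D + Real.log ((m : ℝ) + 1)) * ((n : ℝ≥0∞) + 1)⁻¹ := by
  set N : ℝ≥0∞ := (n : ℝ≥0∞) + 1 with hN
  have hN0 : N ≠ 0 := by simp [hN]
  have hNt : N ≠ ⊤ := by finiteness
  set C := ENNReal.ofReal (Real.log D + Real.log ((m : ℝ) + 1))
  rw [lintegral_prod _ (measurable_truncKernel D m).aemeasurable]
  simp only [lintegral_empirical]
  have h1 : ∀ i, ∑ j, truncKernel D m (x i) (x j)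
      ≤ C + ∑ j ∈ Finset.univ.erase i, scaledKernel D (x i) (x j) := by
    intro i
    rw [← Finset.add_sum_erase _ _ (Finset.mem_univ i)]
    exact add_le_add (truncKernel_le D m _ _)
      (Finset.sum_le_sum fun j _ => truncKernel_le_scaledKernel D m _ _)
  calc N⁻¹ * ∑ i, N⁻¹ * ∑ j, truncKernel D m (x i) (x j)
      ≤ N⁻¹ * ∑ i, N⁻¹ * (C + ∑ j ∈ Finset.univ.erase i, scaledKernel D (x i) (x j)) := by
        gcongr with i _
        exact h1 i
    _ = N⁻¹ * (N⁻¹ * (N * C + discreteEnergy D x)) := by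
        rw [← Finset.mul_sum, Finset.sum_add_distrib, discreteEnergy]
        simp [hN]
    _ ≤ N⁻¹ * (N⁻¹ * (N * C + N * (N * c))) := by gcongr
    _ = c + C * N⁻¹ := by
        have e : N⁻¹ * N = 1 := ENNReal.inv_mul_cancel hN0 hNt
        calc N⁻¹ * (N⁻¹ * (N * C + N * (N * c)))
            = (N⁻¹ * N) * (N⁻¹ * C) + (N⁻¹ * N) * (N⁻¹ * N) * c := by ring
          _ = c + C * N⁻¹ := by rw [e]; ring

/-- **Fekete points**: their empirical measures have an equilibrium measure as a limit point,
and their monic polynomials are asymptotically minimal on `K`. -/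
theorem exists_equilibrium_and_fekete {D : ℝ} {K : Set ℝ} (hK : IsCompact K)
    (hfin : minEnergy D K ≠ ⊤) :
    ∃ (τ : ProbabilityMeasure ℝ) (U : Ultrafilter ℕ) (y : ∀ n : ℕ, Fin (n + 1) → ℝ),
      (τ : Measure ℝ) Kᶜ = 0 ∧ scaledEnergy D τ = minEnergy D K ∧
      (U : Filter ℕ) ≤ atTop ∧ (∀ n i, y n i ∈ K) ∧
      Tendsto (fun n : ℕ => empirical (y n)) U (𝓝 τ) ∧
      ∀ c < minEnergy D K, ∀ᶠ n : ℕ in (U : Filter ℕ), ∀ z ∈ K,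
        ((n : ℝ≥0∞) + 1) * c ≤ ∑ i, scaledKernel D z (y n i) := by
  have hne : K.Nonempty := by
    by_contra h
    rw [not_nonempty_iff_eq_empty] at h
    apply hfin
    simp only [minEnergy, h, compl_empty, iInf_eq_top]
    intro ρ hρ h0
    simp at h0
  choose y hyK hymin using exists_minimizer_discreteEnergy D hK hne
  have hU : ((hyperfilter ℕ : Ultrafilter ℕ) : Filter ℕ) ≤ atTop := by
    rw [← Nat.cofinite_eq_atTop]; exact hyperfilter_le_cofinite
  set U := hyperfilter ℕ
  obtain ⟨τ, hτK, hlim⟩ := exists_tendsto_of_compl_eq_zero hK U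
    (ρs := fun n : ℕ => empirical (y n)) (fun n => empirical_compl_eq_zero (hyK n))
  have hδ : ∀ m : ℕ, Tendsto (fun n : ℕ => ENNReal.ofReal (Real.log D + Real.log ((m : ℝ) + 1))
      * ((n : ℝ≥0∞) + 1)⁻¹) U (𝓝 0) := by
    intro m
    have h1 : Tendsto (fun n : ℕ => ((n : ℝ≥0∞) + 1)⁻¹) atTop (𝓝 0) := by
      have := (ENNReal.tendsto_inv_nat_nhds_zero).comp (tendsto_add_atTop_nat 1)
      refine this.congr fun n => ?_
      simp
    have h2 := ENNReal.Tendsto.const_mul (a := ENNReal.ofReal (Real.log D + Real.log ((m : ℝ) + 1)))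
      h1 (Or.inr ENNReal.ofReal_ne_top)
    rw [mul_zero] at h2
    exact h2.mono_left hU
  -- Used twice: with `c` the energy of any competitor it shows that `τ` is minimal; contraposed,
  -- with `c` below the least energy, it shows that the Fekete energies eventually exceed (n + 1)²
  -- c.
  have hen : ∀ c, (∀ᶠ n : ℕ in (U : Filter ℕ),
      discreteEnergy D (y n) ≤ ((n : ℝ≥0∞) + 1) * (((n : ℝ≥0∞) + 1) * c)) →
      scaledEnergy D τ ≤ c := by
    intro c hc
    refine scaledEnergy_le_of_tendsto hlim hδ fun m => ?_
    filter_upwards [hc] with n hn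
    exact lintegral_truncKernel_empirical_le D m (y n) hn
  have hle : ∀ (ρ : Measure ℝ), IsProbabilityMeasure ρ → ρ Kᶜ = 0 → ∀ n : ℕ,
      discreteEnergy D (y n) ≤ ((n : ℝ≥0∞) + 1) * (((n : ℝ≥0∞) + 1) * scaledEnergy D ρ) := by
    intro ρ hρ h0 n
    refine (discreteEnergy_le_of_minimizer (hymin n) ρ h0).trans ?_
    gcongr
    exact le_self_add
  have hτ : scaledEnergy D τ = minEnergy D K := by
    refine le_antisymm ?_ (iInf₂_le_of_le τ inferInstance (iInf_le _ hτK))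
    refine le_iInf₂ fun ρ hρ => le_iInf fun h0 => ?_
    exact hen _ (Eventually.of_forall fun n => hle ρ hρ h0 n)
  refine ⟨τ, U, y, hτK, hτ, hU, hyK, hlim, fun c hc => ?_⟩
  have hgt : ∀ᶠ n : ℕ in (U : Filter ℕ),
      ¬ discreteEnergy D (y n) ≤ ((n : ℝ≥0∞) + 1) * (((n : ℝ≥0∞) + 1) * c) := by
    -- Along an ultrafilter, failing to hold eventually means failing eventually.
    rw [Ultrafilter.eventually_not]
    intro h
    exact absurd ((hτ ▸ hen c h).trans_lt hc) (lt_irrefl _)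
  filter_upwards [hgt] with n hn z hz
  have hfinn : discreteEnergy D (y n) ≠ ⊤ := by
    refine ne_top_of_le_ne_top ?_ (hle τ inferInstance hτK n)
    rw [hτ]
    finiteness
  have h1 := (not_le.1 hn).le.trans
    (discreteEnergy_le_sum_scaledKernel (hyK n) hfinn (hymin n) hz)
  exact (ENNReal.mul_le_mul_iff_right (by simp) (by finiteness)).1 h1

end Fekete

/-! ### Orthogonal polynomials -/

section OrthogonalPolynomials

lemma integrable_of_continuous_of_compl_Icc {F : Type*} [NormedAddCommGroup F]
    {μ : Measure ℝ} [IsFiniteMeasure μ] {B : ℝ} (hB : μ (Icc (-B) B)ᶜ = 0) {f : ℝ → F}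
    (hf : ContinuousOn f (Icc (-B) B)) : Integrable f μ := by
  have : μ.restrict (Icc (-B) B) = μ := Measure.restrict_eq_self_of_ae_mem (by
    rwa [ae_iff])
  have h := hf.integrableOn_Icc (μ := μ)
  rwa [IntegrableOn, this] at h

lemma integrable_polynomial {μ : Measure ℝ} [IsFiniteMeasure μ] {B : ℝ}
    (hB : μ (Icc (-B) B)ᶜ = 0) (p q : ℝ[X]) : Integrable (fun x => p.eval x * q.eval x) μ :=
  integrable_of_continuous_of_compl_Icc hB (by fun_prop)

lemma integrable_polynomial_sq {μ : Measure ℝ} [IsFiniteMeasure μ] {B : ℝ}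
    (hB : μ (Icc (-B) B)ᶜ = 0) (p : ℝ[X]) : Integrable (fun x => p.eval x ^ 2) μ :=
  integrable_of_continuous_of_compl_Icc hB (by fun_prop)

lemma Polynomial.exists_eq_C_mul_add_of_degree_lt {P : ℝ[X]} (hP : P.Monic) {N : ℕ}
    (hN : P.natDegree = N) {q : ℝ[X]} (hq : q.degree < ((N + 1 : ℕ) : WithBot ℕ)) :
    ∃ (c : ℝ) (r : ℝ[X]), q = Polynomial.C c * P + r ∧ r.degree < (N : WithBot ℕ) := by
  refine ⟨q.coeff N, q - Polynomial.C (q.coeff N) * P, by ring, ?_⟩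
  rw [Polynomial.degree_lt_iff_coeff_zero] at hq ⊢
  intro m hm
  rw [Polynomial.coeff_sub, Polynomial.coeff_C_mul]
  rcases hm.eq_or_lt with h | hm
  · have : P.coeff N = 1 := by rw [← hN]; exact hP.coeff_natDegree
    simp [← h, this]
  · rw [hq m hm, Polynomial.coeff_eq_zero_of_natDegree_lt (p := P) (by omega)]
    simp

namespace IsMonicOrthogonal

variable {μ : Measure ℝ} {P : ℕ → ℝ[X]}

lemma integral_mul_eq_zero [IsFiniteMeasure μ] {B : ℝ} (hB : μ (Icc (-B) B)ᶜ = 0)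
    (hP : IsMonicOrthogonal μ P) {n : ℕ} {q : ℝ[X]} (hq : q.degree < (n : WithBot ℕ)) :
    ∫ x, (P n).eval x * q.eval x ∂μ = 0 := by
  have key : ∀ N ≤ n, ∀ q : ℝ[X], q.degree < (N : WithBot ℕ) →
      ∫ x, (P n).eval x * q.eval x ∂μ = 0 := by
    intro N
    induction N with
    | zero =>
      intro _ q hq
      have : q = 0 := by
        rw [← Polynomial.degree_eq_bot]
        simpa using hq
      simp [this]
    | succ N ih =>
      intro hN q hq
      obtain ⟨c, r, rfl, hr⟩ :=
        Polynomial.exists_eq_C_mul_add_of_degree_lt (hP.monic N) (hP.natDegree N) hq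
      have e : ∀ x, (P n).eval x * (Polynomial.C c * P N + r).eval x
          = c * ((P n).eval x * (P N).eval x) + (P n).eval x * r.eval x := by
        intro x; simp; ring
      simp_rw [e]
      rw [integral_add ((integrable_polynomial hB _ _).const_mul c) (integrable_polynomial hB _ _),
        integral_const_mul, hP.orthogonal n N (by omega), ih (by omega) r hr]
      simp
  exact key n le_rfl q hq

lemma integral_add_sq [IsFiniteMeasure μ] {B : ℝ} (hB : μ (Icc (-B) B)ᶜ = 0)
    (hP : IsMonicOrthogonal μ P) {n : ℕ} {r : ℝ[X]} (hr : r.degree < (n : WithBot ℕ)) (c : ℝ) :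
    ∫ x, (Polynomial.C c * P n + r).eval x ^ 2 ∂μ
      = c ^ 2 * ∫ x, (P n).eval x ^ 2 ∂μ + ∫ x, r.eval x ^ 2 ∂μ := by
  have e : ∀ x, (Polynomial.C c * P n + r).eval x ^ 2
      = c ^ 2 * (P n).eval x ^ 2 + 2 * c * ((P n).eval x * r.eval x) + r.eval x ^ 2 := by
    intro x; simp; ring
  simp_rw [e]
  have i1 : Integrable (fun x => c ^ 2 * (P n).eval x ^ 2) μ :=
    (integrable_polynomial_sq hB _).const_mul _
  have i2 : Integrable (fun x => 2 * c * ((P n).eval x * r.eval x)) μ :=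
    (integrable_polynomial hB _ _).const_mul _
  rw [integral_add (by exact i1.add i2) (integrable_polynomial_sq hB _), integral_add i1 i2,
    integral_const_mul, integral_const_mul, hP.integral_mul_eq_zero hB hr]
  ring

lemma integral_sq_eq_of_monic [IsFiniteMeasure μ] {B : ℝ} (hB : μ (Icc (-B) B)ᶜ = 0)
    (hP : IsMonicOrthogonal μ P) {n : ℕ} {R : ℝ[X]} (hR : R.Monic) (hn : R.natDegree = n) :
    ∫ x, R.eval x ^ 2 ∂μ = ∫ x, (P n).eval x ^ 2 ∂μ + ∫ x, (R - P n).eval x ^ 2 ∂μ := by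
  have hd : (R - P n).degree < (n : WithBot ℕ) := by
    have := Polynomial.degree_sub_lt_left (q := P n)
      (by rw [Polynomial.degree_eq_natDegree hR.ne_zero,
            Polynomial.degree_eq_natDegree (hP.monic n).ne_zero, hn, hP.natDegree]) hR.ne_zero
      (by rw [hR.leadingCoeff, (hP.monic n).leadingCoeff])
    rwa [Polynomial.degree_eq_natDegree hR.ne_zero, hn] at this
  have := hP.integral_add_sq hB hd 1
  simpa using this

/-- Monic orthogonal polynomials have the least norm among monic polynomials. -/
lemma integral_sq_le [IsFiniteMeasure μ] {B : ℝ} (hB : μ (Icc (-B) B)ᶜ = 0)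
    (hP : IsMonicOrthogonal μ P) {n : ℕ} {R : ℝ[X]} (hR : R.Monic) (hn : R.natDegree = n) :
    ∫ x, (P n).eval x ^ 2 ∂μ ≤ ∫ x, R.eval x ^ 2 ∂μ := by
  rw [hP.integral_sq_eq_of_monic hB hR hn]
  exact le_add_of_nonneg_right (integral_nonneg fun x => sq_nonneg _)

/-- The zeros of monic orthogonal polynomials are real, and lie in every interval carrying the
measure. -/
lemma exists_eq_prod [IsFiniteMeasure μ] {B : ℝ} (hB0 : 0 ≤ B) (hB : μ (Icc (-B) B)ᶜ = 0)
    (hdef : ∀ p : ℝ[X], p ≠ 0 → 0 < ∫ x, p.eval x ^ 2 ∂μ)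
    (hP : IsMonicOrthogonal μ P) (n : ℕ) :
    ∃ y : Fin n → ℝ, (∀ i, y i ∈ Icc (-B) B) ∧
      P n = ∏ i, (Polynomial.X - Polynomial.C (y i)) := by
  set p : Polynomial ℂ := (P n).map Complex.ofRealHom with hp
  have hpm : p.Monic := (hP.monic n).map _
  have hsplit : p.Splits := IsAlgClosed.splits p
  have hcard : p.roots.card = n := by
    rw [← hsplit.natDegree_eq_card_roots, hp, (hP.monic n).natDegree_map, hP.natDegree]
  obtain ⟨z, hz⟩ : ∃ z : Fin n → ℂ, Finset.univ.val.map z = p.roots := by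
    obtain ⟨l, hl⟩ : ∃ l : List ℂ, (l : Multiset ℂ) = p.roots := ⟨_, Multiset.coe_toList _⟩
    have hlen : l.length = n := by rw [← hcard, ← hl]; simp
    subst hlen
    refine ⟨l.get, ?_⟩
    rw [← hl]
    simp
  have hprod : p = ∏ i, (Polynomial.X - Polynomial.C (z i)) := by
    conv_lhs => rw [hsplit.eq_prod_roots_of_monic hpm]
    rw [← hz, Multiset.map_map]
    rfl
  -- Replacing every complex zero by its real part, clamped to `[-B, B]`, does not increase the
  -- modulus on the interval. The new monic polynomial has no larger norm, so by uniqueness of the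
  -- minimizer it equals `P n`.
  let y : Fin n → ℝ := fun i => max (-B) (min B (z i).re)
  have hy : ∀ i, y i ∈ Icc (-B) B := fun i =>
    ⟨le_max_left _ _, max_le (by linarith) (min_le_left _ _)⟩
  let R : ℝ[X] := ∏ i, (Polynomial.X - Polynomial.C (y i))
  have hRm : R.Monic := Polynomial.monic_prod_X_sub_C _ _
  have hRd : R.natDegree = n := by simp [R, Polynomial.natDegree_prod_of_monic,
    Polynomial.monic_X_sub_C]
  have hle : ∀ x ∈ Icc (-B) B, |R.eval x| ≤ |(P n).eval x| := by
    intro x hx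
    have h1 : (((P n).eval x : ℝ) : ℂ) = p.eval (x : ℂ) := by
      rw [hp, Polynomial.eval_map, ← Complex.ofRealHom_eq_coe, ← Complex.ofRealHom_eq_coe,
        Polynomial.eval₂_hom]
    have h2 : |(P n).eval x| = ∏ i, ‖(x : ℂ) - z i‖ := by
      rw [← Real.norm_eq_abs, ← Complex.norm_real, h1, hprod, Polynomial.eval_prod, norm_prod]
      simp
    have h3 : |R.eval x| = ∏ i, |x - y i| := by
      simp [R, Polynomial.eval_prod, Finset.abs_prod]
    rw [h2, h3]
    refine Finset.prod_le_prod (fun i _ => abs_nonneg _) fun i _ => ?_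
    have h4 : |x - (z i).re| ≤ ‖(x : ℂ) - z i‖ := by
      simpa using Complex.abs_re_le_norm ((x : ℂ) - z i)
    refine le_trans ?_ h4
    simp only [y]
    rcases le_total B (z i).re with h | h
    · rw [min_eq_left h, max_eq_right (by linarith), abs_of_nonpos (by linarith [hx.2]),
        abs_of_nonpos (by linarith [hx.2])]
      linarith
    · rw [min_eq_right h]
      rcases le_total (-B) (z i).re with h' | h'
      · rw [max_eq_right h']
      · rw [max_eq_left h', abs_of_nonneg (by linarith [hx.1]),
          abs_of_nonneg (by linarith [hx.1])]
        linarith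
  have hint : ∫ x, R.eval x ^ 2 ∂μ ≤ ∫ x, (P n).eval x ^ 2 ∂μ := by
    refine integral_mono_ae (integrable_polynomial_sq hB _) (integrable_polynomial_sq hB _) ?_
    have hae : ∀ᵐ x ∂μ, x ∈ Icc (-B) B := by rwa [ae_iff]
    filter_upwards [hae] with x hx
    exact sq_le_sq.2 (hle x hx)
  rw [hP.integral_sq_eq_of_monic hB hRm hRd] at hint
  have h0 : R - P n = 0 := by
    by_contra hne
    have := hdef _ hne
    linarith
  exact ⟨y, hy, (sub_eq_zero.1 h0).symm⟩

/-- The values of a polynomial are controlled by its norm and the orthonormal polynomials. -/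
lemma abs_eval_le [IsFiniteMeasure μ] {B : ℝ} (hB : μ (Icc (-B) B)ᶜ = 0)
    (hdef : ∀ p : ℝ[X], p ≠ 0 → 0 < ∫ x, p.eval x ^ 2 ∂μ)
    (hP : IsMonicOrthogonal μ P) (N : ℕ) (x : ℝ) (p : ℝ[X])
    (hp : p.degree < (N : WithBot ℕ)) :
    |p.eval x| ≤ √(∫ t, p.eval t ^ 2 ∂μ)
      * ∑ j ∈ Finset.range N, |(P j).eval x| / √(∫ t, (P j).eval t ^ 2 ∂μ) := by
  induction N generalizing p with
  | zero =>
    have : p = 0 := by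
      rw [← Polynomial.degree_eq_bot]
      simpa using hp
    simp [this]
  | succ N ih =>
    obtain ⟨c, r, rfl, hr⟩ :=
      Polynomial.exists_eq_C_mul_add_of_degree_lt (hP.monic N) (hP.natDegree N) hp
    have hpos := hdef _ (hP.monic N).ne_zero
    have e := hP.integral_add_sq hB hr c
    have hr0 : 0 ≤ ∫ t, r.eval t ^ 2 ∂μ := integral_nonneg fun t => sq_nonneg _
    -- By Pythagoras, neither the top component nor the remainder exceeds the whole in norm.
    have h1 : |c| * √(∫ t, (P N).eval t ^ 2 ∂μ)
        ≤ √(∫ t, (Polynomial.C c * P N + r).eval t ^ 2 ∂μ) := by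
      rw [e, ← Real.sqrt_sq_eq_abs, ← Real.sqrt_mul (sq_nonneg c)]
      exact Real.sqrt_le_sqrt (by linarith)
    have h2 : √(∫ t, r.eval t ^ 2 ∂μ)
        ≤ √(∫ t, (Polynomial.C c * P N + r).eval t ^ 2 ∂μ) := by
      rw [e]
      exact Real.sqrt_le_sqrt (by nlinarith [sq_nonneg c])
    rw [Finset.sum_range_succ, mul_add]
    have hs : 0 < √(∫ t, (P N).eval t ^ 2 ∂μ) := Real.sqrt_pos.2 hpos
    calc |(Polynomial.C c * P N + r).eval x| ≤ |r.eval x| + |c| * |(P N).eval x| := by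
          rw [Polynomial.eval_add, Polynomial.eval_mul, Polynomial.eval_C, ← abs_mul, add_comm]
          exact abs_add_le _ _
      _ ≤ _ := by
          refine add_le_add ((ih r hr).trans ?_) ?_
          · exact mul_le_mul_of_nonneg_right h2
              (Finset.sum_nonneg fun j _ => div_nonneg (abs_nonneg _) (Real.sqrt_nonneg _))
          · rw [mul_div_assoc', le_div_iff₀ hs]
            nlinarith [abs_nonneg ((P N).eval x)]

end IsMonicOrthogonal

/-- Monic orthogonal polynomials exist as soon as the `L²` form is positive definite. -/
lemma exists_isMonicOrthogonal {μ : Measure ℝ} [IsFiniteMeasure μ] {B : ℝ}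
    (hB : μ (Icc (-B) B)ᶜ = 0) (hdef : ∀ p : ℝ[X], p ≠ 0 → 0 < ∫ x, p.eval x ^ 2 ∂μ) :
    ∃ P, IsMonicOrthogonal μ P := by
  have hint := integrable_polynomial hB
  let T : ℝ[X] →ₗ[ℝ] ℝ[X] →ₗ[ℝ] ℝ := LinearMap.mk₂ ℝ
    (fun p q => ∫ x, p.eval x * q.eval x ∂μ)
    (fun p₁ p₂ q => by
      rw [← integral_add (hint _ _) (hint _ _)]; congr 1; ext x; simp; ring)
    (fun c p q => by
      rw [smul_eq_mul, ← integral_const_mul]; congr 1; ext x; simp; ring)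
    (fun p q₁ q₂ => by
      rw [← integral_add (hint _ _) (hint _ _)]; congr 1; ext x; simp; ring)
    (fun c p q => by
      rw [smul_eq_mul, ← integral_const_mul]; congr 1; ext x; simp; ring)
  have hT : ∀ p q, T p q = ∫ x, p.eval x * q.eval x ∂μ := fun p q => rfl
  have key : ∀ n : ℕ, ∃ p : ℝ[X], p.Monic ∧ p.natDegree = n ∧
      ∀ q : ℝ[X], q.degree < (n : WithBot ℕ) → ∫ x, p.eval x * q.eval x ∂μ = 0 := by
    intro n
    let V := Polynomial.degreeLT ℝ n
    have hfd : FiniteDimensional ℝ V :=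
      (Polynomial.degreeLTEquiv ℝ n).symm.finiteDimensional
    -- The Gram form on polynomials of degree below `n` is injective, hence onto the dual; the
    -- preimage of pairing with `X ^ n` is the orthogonal projection of `X ^ n`.
    let S : V →ₗ[ℝ] Module.Dual ℝ V := T.domRestrict₁₂ V V
    have hinj : Function.Injective S := by
      rw [injective_iff_map_eq_zero]
      intro v hv
      by_contra hne
      have h1 : S v v = 0 := by rw [hv]; rfl
      have h2 : S v v = ∫ x, (v : ℝ[X]).eval x ^ 2 ∂μ := by
        change T v v = _
        rw [hT]; simp_rw [sq]
      have h3 := hdef v (fun h => hne (Subtype.ext h))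
      linarith
    have hsurj : Function.Surjective S :=
      (LinearMap.injective_iff_surjective_of_finrank_eq_finrank
        (Subspace.dual_finrank_eq).symm).1 hinj
    obtain ⟨v, hv⟩ := hsurj ((T (Polynomial.X ^ n)).comp V.subtype)
    have hvd : (v : ℝ[X]).degree < (n : WithBot ℕ) := Polynomial.mem_degreeLT.1 v.2
    refine ⟨Polynomial.X ^ n - (v : ℝ[X]), Polynomial.monic_X_pow_sub hvd, ?_, fun q hq => ?_⟩
    · refine Polynomial.natDegree_eq_of_degree_eq_some ?_
      rw [Polynomial.degree_sub_eq_left_of_degree_lt (by rwa [Polynomial.degree_X_pow]),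
        Polynomial.degree_X_pow]
    · have h1 := LinearMap.congr_fun hv ⟨q, Polynomial.mem_degreeLT.2 hq⟩
      change T v q = T (Polynomial.X ^ n) q at h1
      rw [← hT, map_sub, LinearMap.sub_apply, h1, sub_self]
  choose P hm hd ho using key
  refine ⟨P, hm, hd, fun n m hnm => ?_⟩
  rcases lt_or_gt_of_ne hnm with h | h
  · simp_rw [mul_comm ((P n).eval _)]
    refine ho m (P n) ?_
    rw [Polynomial.degree_eq_natDegree (hm n).ne_zero, hd]
    exact_mod_cast h
  · refine ho n (P m) ?_
    rw [Polynomial.degree_eq_natDegree (hm m).ne_zero, hd]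
    exact_mod_cast h

lemma eLpNorm_polynomial_eq {μ : Measure ℝ} [IsFiniteMeasure μ] {B : ℝ}
    (hB : μ (Icc (-B) B)ᶜ = 0) (p : ℝ[X]) :
    eLpNorm (fun x => p.eval x) 2 μ = ENNReal.ofReal (√(∫ x, p.eval x ^ 2 ∂μ)) := by
  have hm : MemLp (fun x => p.eval x) 2 μ := by
    rw [memLp_two_iff_integrable_sq (by fun_prop)]
    exact integrable_polynomial_sq hB p
  rw [hm.eLpNorm_eq_integral_rpow_norm (by simp) (by simp)]
  congr 1
  rw [Real.sqrt_eq_rpow]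
  simp

lemma noAtoms_of_scaledEnergy_ne_top {D : ℝ} {ρ : Measure ℝ} (h : scaledEnergy D ρ ≠ ⊤) (z : ℝ) :
    ρ {z} = 0 := by
  by_contra hz
  have h1 : scaledPotential D ρ z = ⊤ := by
    refine top_unique ?_
    calc ⊤ = ⊤ * ρ {z} := (ENNReal.top_mul hz).symm
      _ = ∫⁻ y in {z}, scaledKernel D z y ∂ρ := by
          rw [lintegral_singleton, scaledKernel_self]
      _ ≤ _ := setLIntegral_le_lintegral _ _
  apply h
  refine top_unique ?_
  calc ⊤ = ⊤ * ρ {z} := (ENNReal.top_mul hz).symm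
    _ = ∫⁻ x in {z}, scaledPotential D ρ x ∂ρ := by
        rw [lintegral_singleton, h1]
    _ ≤ _ := setLIntegral_le_lintegral _ _

lemma exists_scaledEnergy_ne_top {D : ℝ} {K : Set ℝ} (h : minEnergy D K ≠ ⊤) :
    ∃ ρ : Measure ℝ, IsProbabilityMeasure ρ ∧ ρ Kᶜ = 0 ∧ scaledEnergy D ρ ≠ ⊤ := by
  by_contra hcon
  push Not at hcon
  apply h
  simp only [minEnergy, iInf_eq_top]
  exact fun ρ hρ h0 => hcon ρ hρ h0

/-- If the support has finite energy, then the `L²` form is positive definite on polynomials. -/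
lemma integral_sq_pos {μ : Measure ℝ} [IsFiniteMeasure μ] {B : ℝ}
    (hB : μ (Icc (-B) B)ᶜ = 0) {D : ℝ} (hfin : minEnergy D μ.support ≠ ⊤) (p : ℝ[X])
    (hp : p ≠ 0) : 0 < ∫ x, p.eval x ^ 2 ∂μ := by
  refine lt_of_le_of_ne (integral_nonneg fun x => sq_nonneg _) fun h0 => ?_
  -- A polynomial vanishing almost everywhere would confine the support to its finitely many zeros,
  -- but a measure of finite energy has no atoms.
  have h1 := (integral_eq_zero_iff_of_nonneg (fun x => sq_nonneg _)
    (integrable_polynomial_sq hB p)).1 h0.symm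
  have hZf : {x | p.eval x = 0}.Finite := by
    refine (p.roots.toFinset.finite_toSet).subset fun x hx => ?_
    simpa [hp] using hx
  have hsub : μ.support ⊆ {x | p.eval x = 0} := by
    refine Measure.support_subset_of_isClosed hZf.isClosed ?_
    filter_upwards [h1] with x hx
    simpa using hx
  obtain ⟨ρ, hρ, hρK, hρe⟩ := exists_scaledEnergy_ne_top hfin
  have h2 : ρ {x | p.eval x = 0} = 0 := by
    rw [← biUnion_of_singleton {x | p.eval x = 0}, measure_biUnion_null_iff hZf.countable]
    exact fun z _ => noAtoms_of_scaledEnergy_ne_top hρe z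
  have h3 : ρ univ = 0 := by
    rw [← union_compl_self μ.support]
    exact measure_union_null (measure_mono_null hsub h2) hρK
  simp at h3

end OrthogonalPolynomials

/-! ### Moments and the behaviour of potentials at infinity -/

section Moments

lemma tendsto_integral_of_continuousOn_Icc {ι : Type*} {F : Filter ι}
    {ρs : ι → ProbabilityMeasure ℝ} {σ : ProbabilityMeasure ℝ} (h : Tendsto ρs F (𝓝 σ))
    {B : ℝ} (hB0 : 0 ≤ B) (hρ : ∀ i, (ρs i : Measure ℝ) (Icc (-B) B)ᶜ = 0)
    (hσ : (σ : Measure ℝ) (Icc (-B) B)ᶜ = 0) {f : ℝ → ℝ} (hf : ContinuousOn f (Icc (-B) B)) :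
    Tendsto (fun i => ∫ x, f x ∂(ρs i : Measure ℝ)) F (𝓝 (∫ x, f x ∂(σ : Measure ℝ))) := by
  have hle : -B ≤ B := by linarith
  obtain ⟨C, hC⟩ := isCompact_Icc.exists_bound_of_continuousOn hf
  let g : ℝ → ℝ := IccExtend hle ((Icc (-B) B).domRestrict f)
  have hg : Continuous g := (continuousOn_iff_continuous_domRestrict.1 hf).Icc_extend'
  let G : BoundedContinuousFunction ℝ ℝ :=
    BoundedContinuousFunction.ofNormedAddCommGroup g hg C fun x => hC _ (projIcc _ _ hle x).2
  have e : ∀ ρ : Measure ℝ, ρ (Icc (-B) B)ᶜ = 0 → ∫ x, G x ∂ρ = ∫ x, f x ∂ρ := by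
    intro ρ hρ
    refine integral_congr_ae ?_
    have hae : ∀ᵐ x ∂ρ, x ∈ Icc (-B) B := by rwa [ae_iff]
    filter_upwards [hae] with x hx
    change IccExtend hle ((Icc (-B) B).domRestrict f) x = f x
    rw [IccExtend_of_mem hle _ hx]
    rfl
  have := ProbabilityMeasure.tendsto_iff_forall_integral_tendsto.1 h G
  rw [e _ hσ] at this
  exact this.congr fun i => e _ (hρ i)

/-- Measures carried by a bounded interval are determined by their moments. -/
lemma eq_of_forall_moment_eq {σ τ : Measure ℝ} [IsProbabilityMeasure σ] [IsProbabilityMeasure τ]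
    {B : ℝ} (hσ : σ (Icc (-B) B)ᶜ = 0) (hτ : τ (Icc (-B) B)ᶜ = 0)
    (h : ∀ j : ℕ, ∫ x, x ^ j ∂σ = ∫ x, x ^ j ∂τ) : σ = τ := by
  have hpoly : ∀ p : ℝ[X], ∫ x, p.eval x ∂σ = ∫ x, p.eval x ∂τ := by
    intro p
    simp_rw [Polynomial.eval_eq_sum_range]
    rw [integral_finsetSum, integral_finsetSum]
    · simp_rw [integral_const_mul, h]
    · exact fun i _ => integrable_of_continuous_of_compl_Icc hτ (by fun_prop)
    · exact fun i _ => integrable_of_continuous_of_compl_Icc hσ (by fun_prop)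
  refine ext_of_forall_integral_eq_of_IsFiniteMeasure fun f => ?_
  refine eq_of_abs_sub_le_all fun ε hε => ?_
  obtain ⟨p, hp⟩ := exists_polynomial_near_of_continuousOn (-B) B f f.continuous.continuousOn
    (ε / 2) (by linarith)
  have key : ∀ ρ : Measure ℝ, IsProbabilityMeasure ρ → ρ (Icc (-B) B)ᶜ = 0 →
      |∫ x, f x ∂ρ - ∫ x, p.eval x ∂ρ| ≤ ε / 2 := by
    intro ρ _ hρ
    rw [← integral_sub (integrable_of_continuous_of_compl_Icc hρ f.continuous.continuousOn)
      (integrable_of_continuous_of_compl_Icc hρ (by fun_prop))]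
    have := norm_integral_le_of_norm_le_const (μ := ρ) (C := ε / 2)
      (f := fun x => f x - p.eval x) (by
        have hae : ∀ᵐ x ∂ρ, x ∈ Icc (-B) B := by rwa [ae_iff]
        filter_upwards [hae] with x hx
        rw [Real.norm_eq_abs, abs_sub_comm]
        exact (hp x hx).le)
    simpa using this
  have h1 := abs_le.1 (key σ inferInstance hσ)
  have h2 := abs_le.1 (key τ inferInstance hτ)
  rw [hpoly p] at h1
  rw [abs_le]
  constructor <;> linarith [h1.1, h1.2, h2.1, h2.2]

/-- With `w = 1 / z` this expands the potential at infinity; integrating in `y` turns the sum into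
moments. The term `j = 0` is zero because of division by zero. -/
lemma abs_log_norm_sub_taylor_le (J : ℕ) (w : ℂ) {y : ℝ} (h : ‖w‖ * |y| ≤ 1 / 2) :
    |Real.log ‖1 - w * y‖
      - ∑ j ∈ Finset.range (J + 1), ((-1) ^ (j + 1) * (-w) ^ j / j : ℂ).re * y ^ j|
      ≤ 2 * (‖w‖ * |y|) ^ (J + 1) := by
  set u : ℂ := -(w * y) with hu
  have hun : ‖u‖ = ‖w‖ * |y| := by simp [hu]
  have h1 := Complex.norm_log_sub_logTaylor_le J (z := u) (by rw [hun]; linarith)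
  have h2 : (Complex.log (1 + u)).re = Real.log ‖1 - w * y‖ := by
    rw [Complex.log_re, hu, sub_eq_add_neg]
  have h3 : (Complex.logTaylor (J + 1) u).re
      = ∑ j ∈ Finset.range (J + 1), ((-1) ^ (j + 1) * (-w) ^ j / j : ℂ).re * y ^ j := by
    rw [Complex.logTaylor, Complex.re_sum]
    refine Finset.sum_congr rfl fun j _ => ?_
    rw [← Complex.re_mul_ofReal]
    congr 1
    rw [hu]
    push_cast
    rw [neg_mul_eq_neg_mul, mul_pow]
    ring
  rw [← h2, ← h3, ← Complex.sub_re]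
  refine (Complex.abs_re_le_norm _).trans (h1.trans ?_)
  rw [hun] at *
  have h5 : (1 - ‖w‖ * |y|)⁻¹ ≤ 2 := by
    rw [inv_le_comm₀ (by linarith) (by norm_num)]
    linarith
  have h6 : 0 ≤ (‖w‖ * |y|) ^ (J + 1) := by positivity
  rw [div_le_iff₀ (by positivity)]
  calc (‖w‖ * |y|) ^ (J + 1) * (1 - ‖w‖ * |y|)⁻¹ ≤ (‖w‖ * |y|) ^ (J + 1) * 2 := by gcongr
    _ ≤ 2 * (‖w‖ * |y|) ^ (J + 1) * (J + 1) := by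
        have : (0 : ℝ) ≤ J := by positivity
        nlinarith

lemma sub_pos_of_mem_Icc {B y : ℝ} {z : ℂ} (hz : B < ‖z‖) (hy : y ∈ Icc (-B) B) :
    0 < ‖z - y‖ := by
  have h1 : |y| ≤ B := abs_le.2 hy
  have h2 : ‖z‖ - |y| ≤ ‖z - y‖ := by
    simpa using norm_sub_norm_le z (y : ℂ)
  linarith

lemma continuousOn_log_norm_sub {B : ℝ} {z : ℂ} (hz : B < ‖z‖) :
    ContinuousOn (fun y : ℝ => Real.log ‖z - y‖) (Icc (-B) B) := by
  refine ContinuousOn.log (by fun_prop) fun y hy => (sub_pos_of_mem_Icc hz hy).ne'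

/-- A minimum principle at infinity: if one logarithmic potential dominates another one near
infinity in the complex plane, the two measures coincide. -/
lemma eq_of_forall_integral_log_le {σ τ : Measure ℝ} [IsProbabilityMeasure σ]
    [IsProbabilityMeasure τ] {B : ℝ} (hB0 : 0 < B) (hσ : σ (Icc (-B) B)ᶜ = 0)
    (hτ : τ (Icc (-B) B)ᶜ = 0)
    (h : ∀ z : ℂ, B < ‖z‖ → ∫ y : ℝ, Real.log ‖z - y‖ ∂τ ≤ ∫ y : ℝ, Real.log ‖z - y‖ ∂σ) :
    σ = τ := by
  refine eq_of_forall_moment_eq hσ hτ fun J => ?_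
  induction J using Nat.strong_induction_on with
  | _ J ih =>
  rcases Nat.eq_zero_or_pos J with rfl | hJ
  · simp
  have hmom : ∀ ρ : Measure ℝ, IsProbabilityMeasure ρ → ρ (Icc (-B) B)ᶜ = 0 → ∀ w : ℂ, w ≠ 0 →
      ‖w‖ * B ≤ 1 / 2 → |(∫ y : ℝ, Real.log ‖w⁻¹ - y‖ ∂ρ) + Real.log ‖w‖
        - ∑ j ∈ Finset.range (J + 1), ((-1) ^ (j + 1) * (-w) ^ j / j : ℂ).re * ∫ y, y ^ j ∂ρ|
        ≤ 2 * (‖w‖ * B) ^ (J + 1) := by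
    intro ρ _ hρ w hw hwB
    have hwpos : 0 < ‖w‖ := norm_pos_iff.2 hw
    have hz : B < ‖w⁻¹‖ := by
      rw [norm_inv, lt_inv_comm₀ hB0 hwpos, ← one_div, lt_div_iff₀ hB0]
      linarith
    have hae : ∀ᵐ y ∂ρ, y ∈ Icc (-B) B := by rwa [ae_iff]
    have e1 : ∑ j ∈ Finset.range (J + 1),
        ((-1) ^ (j + 1) * (-w) ^ j / j : ℂ).re * ∫ y, y ^ j ∂ρ
        = ∫ y, ∑ j ∈ Finset.range (J + 1),
          ((-1) ^ (j + 1) * (-w) ^ j / j : ℂ).re * y ^ j ∂ρ := by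
      rw [integral_finsetSum]
      · simp_rw [integral_const_mul]
      · exact fun i _ => integrable_of_continuous_of_compl_Icc hρ (by fun_prop)
    have e2 : (∫ y : ℝ, Real.log ‖w⁻¹ - y‖ ∂ρ) + Real.log ‖w‖
        = ∫ y : ℝ, (Real.log ‖w⁻¹ - y‖ + Real.log ‖w‖) ∂ρ := by
      rw [integral_add (integrable_of_continuous_of_compl_Icc hρ (continuousOn_log_norm_sub hz))
        (integrable_const _)]
      simp
    rw [e1, e2, ← integral_sub]
    · have := norm_integral_le_of_norm_le_const (μ := ρ) (C := 2 * (‖w‖ * B) ^ (J + 1))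
        (f := fun y : ℝ => (Real.log ‖w⁻¹ - y‖ + Real.log ‖w‖)
          - ∑ j ∈ Finset.range (J + 1), ((-1) ^ (j + 1) * (-w) ^ j / j : ℂ).re * y ^ j) (by
          filter_upwards [hae] with y hy
          have hyB : |y| ≤ B := abs_le.2 hy
          have h1 : ‖w‖ * |y| ≤ ‖w‖ * B := by gcongr
          have h2 : Real.log ‖w⁻¹ - y‖ + Real.log ‖w‖ = Real.log ‖1 - w * y‖ := by
            rw [← Real.log_mul (sub_pos_of_mem_Icc hz hy).ne' hwpos.ne', ← norm_mul]
            congr 2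
            rw [sub_mul, inv_mul_cancel₀ hw, mul_comm w]
          rw [h2, Real.norm_eq_abs]
          refine (abs_log_norm_sub_taylor_le J w (h1.trans hwB)).trans ?_
          gcongr)
      simpa using this
    · exact (integrable_of_continuous_of_compl_Icc hρ (continuousOn_log_norm_sub hz)).add
        (integrable_const _)
    · exact integrable_finsetSum _ fun i _ =>
        integrable_of_continuous_of_compl_Icc hρ (by fun_prop)
  set d := ∫ y, y ^ J ∂σ - ∫ y, y ^ J ∂τ with hd
  have hJ' : (0 : ℝ) < J := by exact_mod_cast hJ
  have hC : 0 < 4 * J * B ^ (J + 1) := by positivity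
  -- Once the lower moments agree, the difference of the potentials at 1 / (r ζ) is -(r ^ J * s / J)
  -- * d up to O(r ^ (J + 1)). The directions with `ζ ^ J = 1` and `ζ ^ J = -1` give both signs of
  -- `d`.
  have key : ∀ (s : ℝ) (ζ : ℂ), ζ ^ J = (s : ℂ) → |s| = 1 → s * d ≤ 0 := by
    intro s ζ hζ hs
    have hζn : ‖ζ‖ = 1 := by
      have : ‖ζ‖ ^ J = 1 := by rw [← norm_pow, hζ]; simpa using hs
      exact (pow_eq_one_iff_of_nonneg (norm_nonneg _) hJ.ne').1 this
    have hr : ∀ r : ℝ, 0 < r → r * B ≤ 1 / 2 → s * d ≤ (4 * J * B ^ (J + 1)) * r := by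
      intro r hr hrB
      set w : ℂ := r * ζ with hw
      have hwn : ‖w‖ = r := by simp [hw, hζn, abs_of_pos hr]
      have hw0 : w ≠ 0 := by rw [← norm_pos_iff, hwn]; exact hr
      have hz : B < ‖w⁻¹‖ := by
        rw [norm_inv, hwn, lt_inv_comm₀ hB0 hr, ← one_div, lt_div_iff₀ hB0]
        linarith
      have h1 := abs_le.1 (hmom σ inferInstance hσ w hw0 (by rw [hwn]; exact hrB))
      have h2 := abs_le.1 (hmom τ inferInstance hτ w hw0 (by rw [hwn]; exact hrB))
      have h3 := h _ hz
      have ha : ((-1) ^ (J + 1) * (-w) ^ J / J : ℂ).re = -(r ^ J * s / J) := by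
        have : ((-1) ^ (J + 1) * (-w) ^ J / J : ℂ) = ((-(r ^ J * s / J) : ℝ) : ℂ) := by
          push_cast
          rw [neg_pow w, ← mul_assoc, ← pow_add, hw, mul_pow, hζ, show J + 1 + J = 2 * J + 1 by ring,
            pow_succ, pow_mul]
          simp; ring
        rw [this, Complex.ofReal_re]
      rw [Finset.sum_range_succ, ha] at h1 h2
      have h4 : ∑ j ∈ Finset.range J, ((-1) ^ (j + 1) * (-w) ^ j / j : ℂ).re * ∫ y, y ^ j ∂σ
          = ∑ j ∈ Finset.range J, ((-1) ^ (j + 1) * (-w) ^ j / j : ℂ).re * ∫ y, y ^ j ∂τ :=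
        Finset.sum_congr rfl fun j hj => by rw [ih j (Finset.mem_range.1 hj)]
      rw [h4, hwn] at h1
      rw [hwn] at h2
      have h5 : r ^ J * s / J * d ≤ 4 * (r * B) ^ (J + 1) := by
        rw [hd]
        linarith [h1.2, h2.1]
      have h6 : r ^ J * (s * d) ≤ r ^ J * ((4 * J * B ^ (J + 1)) * r) := by
        have : r ^ J * s / J * d = r ^ J * (s * d) / J := by ring
        rw [this, div_le_iff₀ hJ'] at h5
        calc _ ≤ _ := h5
          _ = _ := by rw [mul_pow, pow_succ r]; ring
      exact le_of_mul_le_mul_left h6 (pow_pos hr J)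
    by_contra hcon
    rw [not_le] at hcon
    set C := 4 * J * B ^ (J + 1)
    -- The first entry keeps the expansion valid; the second makes the error at most half of `s *
    -- d`.
    have h7 := hr (min (1 / (2 * B)) (s * d / (2 * C))) (by positivity) (by
      calc min (1 / (2 * B)) (s * d / (2 * C)) * B ≤ 1 / (2 * B) * B := by
            gcongr; exact min_le_left _ _
        _ = 1 / 2 := by field_simp)
    have h8 : C * min (1 / (2 * B)) (s * d / (2 * C)) ≤ s * d / 2 := by
      calc C * min (1 / (2 * B)) (s * d / (2 * C)) ≤ C * (s * d / (2 * C)) := by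
            gcongr; exact min_le_right _ _
        _ = s * d / 2 := by field_simp
    linarith
  have k1 := key 1 1 (by simp) (by simp)
  obtain ⟨ζ, hζ⟩ := IsAlgClosed.exists_pow_nat_eq (-1 : ℂ) hJ
  have k2 := key (-1) ζ (by simpa using hζ) (by simp)
  linarith

end Moments

/-! ### Comparison of polynomials off the real interval -/

section CauchyBound

/-- The map ζ ↦ 1 / (1 - ζ) sends the unit disc into the half-plane Re > 1/2. -/
lemma half_le_re_div_sub {z : ℂ} {x : ℝ} (h : |x| < ‖z‖) : 1 / 2 ≤ (z / (z - x)).re := by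
  have hne : z - x ≠ 0 := by
    intro h0
    rw [sub_eq_zero] at h0
    rw [h0] at h
    simp at h
  have hpos : 0 < Complex.normSq (z - x) := Complex.normSq_pos.2 hne
  have h1 : x ^ 2 < Complex.normSq z := by
    rw [Complex.normSq_eq_norm_sq, ← sq_abs]
    gcongr
  rw [Complex.div_re, ← add_div, le_div_iff₀ hpos]
  simp only [Complex.normSq_apply, Complex.sub_re, Complex.sub_im, Complex.ofReal_re,
    Complex.ofReal_im] at *
  nlinarith

lemma integral_mul_eval_complex_eq_zero {μ : Measure ℝ} [IsFiniteMeasure μ] {B : ℝ}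
    (hB : μ (Icc (-B) B)ᶜ = 0) {P : ℕ → ℝ[X]} (hP : IsMonicOrthogonal μ P) {n : ℕ}
    {s : Polynomial ℂ} (hs : s.degree < (n : WithBot ℕ)) :
    ∫ x : ℝ, (((P n).eval x : ℝ) : ℂ) * s.eval (x : ℂ) ∂μ = 0 := by
  simp_rw [Polynomial.eval_eq_sum_range (p := s), Finset.mul_sum]
  rw [integral_finsetSum]
  · refine Finset.sum_eq_zero fun i _ => ?_
    by_cases hi : s.coeff i = 0
    · simp [hi]
    have hin : i < n := by
      by_contra hcon
      exact hi ((Polynomial.degree_lt_iff_coeff_zero _ _).1 hs i (not_lt.1 hcon))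
    have e : ∀ x : ℝ, (((P n).eval x : ℝ) : ℂ) * (s.coeff i * (x : ℂ) ^ i)
        = s.coeff i * (((P n).eval x * (Polynomial.X ^ i : ℝ[X]).eval x : ℝ) : ℂ) := by
      intro x; simp; ring
    simp_rw [e]
    rw [integral_const_mul, integral_complex_ofReal, hP.integral_mul_eq_zero hB]
    · simp
    · rw [Polynomial.degree_X_pow]; exact_mod_cast hin
  · exact fun i _ => integrable_of_continuous_of_compl_Icc hB (by fun_prop)

/-- Off the interval carrying the measure, orthonormal polynomials are at least as large as every
polynomial of the same degree bounded by one, up to a constant. -/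
lemma norm_aeval_mul_le {μ : Measure ℝ} [IsFiniteMeasure μ] {B : ℝ}
    (hB : μ (Icc (-B) B)ᶜ = 0) {P : ℕ → ℝ[X]} (hP : IsMonicOrthogonal μ P) {n : ℕ}
    {z : ℂ} (hz : B < ‖z‖) (hpos : 0 < ∫ x, (P n).eval x ^ 2 ∂μ)
    {r : ℝ[X]} (hr : r.natDegree ≤ n) {M : ℝ} (hM : ∀ᵐ x ∂μ, |r.eval x| ≤ M) :
    ‖Polynomial.aeval z r‖ * √(∫ x, (P n).eval x ^ 2 ∂μ)
      ≤ ‖z‖ / (‖z‖ - B) * (1 + μ.real univ) * (‖Polynomial.aeval z (P n)‖ * M) := by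
  set p : Polynomial ℂ := (P n).map Complex.ofRealHom with hp
  set q : Polynomial ℂ := r.map Complex.ofRealHom with hq
  have evp : ∀ x : ℝ, p.eval (x : ℂ) = (((P n).eval x : ℝ) : ℂ) := fun x => by
    rw [hp, Polynomial.eval_map, ← Complex.ofRealHom_eq_coe, ← Complex.ofRealHom_eq_coe,
      Polynomial.eval₂_hom]
  have evq : ∀ x : ℝ, q.eval (x : ℂ) = ((r.eval x : ℝ) : ℂ) := fun x => by
    rw [hq, Polynomial.eval_map, ← Complex.ofRealHom_eq_coe, ← Complex.ofRealHom_eq_coe,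
      Polynomial.eval₂_hom]
  have ap : Polynomial.aeval z (P n) = p.eval z := by
    rw [hp, Polynomial.eval_map, Polynomial.aeval_def]; rfl
  have aq : Polynomial.aeval z r = q.eval z := by
    rw [hq, Polynomial.eval_map, Polynomial.aeval_def]; rfl
  rw [ap, aq]
  -- `T` vanishes at `z`, so T / (X - z) has degree below `n` and is orthogonal to `P n`. This
  -- trades q(z) ∫ P n² z/(z - x) for p(z) ∫ P n r z/(z - x); the first integral is bounded below by
  -- its real part, the second above by `M`.
  set T : Polynomial ℂ := Polynomial.C (q.eval z) * p - Polynomial.C (p.eval z) * q with hT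
  have hroot : T.IsRoot z := by simp [hT, Polynomial.IsRoot, mul_comm]
  obtain ⟨s, hs⟩ := Polynomial.dvd_iff_isRoot.2 hroot
  have hTd : T.natDegree ≤ n := by
    refine (Polynomial.natDegree_sub_le _ _).trans (max_le ?_ ?_)
    · refine (Polynomial.natDegree_C_mul_le _ _).trans ?_
      exact Polynomial.natDegree_map_le.trans (hP.natDegree n).le
    · exact (Polynomial.natDegree_C_mul_le _ _).trans (Polynomial.natDegree_map_le.trans hr)
  have hsd : s.degree < (n : WithBot ℕ) := by
    by_cases hs0 : s = 0
    · rw [hs0, Polynomial.degree_zero]; exact WithBot.bot_lt_coe n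
    · have : T.natDegree = 1 + s.natDegree := by
        rw [hs, Polynomial.natDegree_mul (Polynomial.X_sub_C_ne_zero z) hs0,
          Polynomial.natDegree_X_sub_C]
      rw [Polynomial.degree_eq_natDegree hs0]
      exact_mod_cast (by omega : s.natDegree < n)
  have h0 := integral_mul_eval_complex_eq_zero hB hP hsd
  have hae : ∀ᵐ x ∂μ, x ∈ Icc (-B) B := by rwa [ae_iff]
  have hne : ∀ x ∈ Icc (-B) B, z - (x : ℂ) ≠ 0 := fun x hx =>
    norm_pos_iff.1 (sub_pos_of_mem_Icc hz hx)
  have hker : ContinuousOn (fun x : ℝ => z / (z - x)) (Icc (-B) B) :=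
    ContinuousOn.div (by fun_prop) (by fun_prop) hne
  have i1 : Integrable (fun x : ℝ => (((P n).eval x ^ 2 : ℝ) : ℂ) * (z / (z - x))) μ :=
    integrable_of_continuous_of_compl_Icc hB (ContinuousOn.mul (by fun_prop) hker)
  have i2 : Integrable (fun x : ℝ => (((P n).eval x * r.eval x : ℝ) : ℂ) * (z / (z - x))) μ :=
    integrable_of_continuous_of_compl_Icc hB (ContinuousOn.mul (by fun_prop) hker)
  have ident : q.eval z * ∫ x : ℝ, (((P n).eval x ^ 2 : ℝ) : ℂ) * (z / (z - x)) ∂μ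
      = p.eval z * ∫ x : ℝ, (((P n).eval x * r.eval x : ℝ) : ℂ) * (z / (z - x)) ∂μ := by
    rw [← sub_eq_zero, ← integral_const_mul, ← integral_const_mul,
      ← integral_sub (i1.const_mul _) (i2.const_mul _)]
    rw [← mul_zero (-z), ← h0, ← integral_const_mul]
    refine integral_congr_ae ?_
    filter_upwards [hae] with x hx
    have hev := congrArg (Polynomial.eval (x : ℂ)) hs
    simp only [hT, Polynomial.eval_sub, Polynomial.eval_mul, Polynomial.eval_C,
      Polynomial.eval_X, evp, evq] at hev
    have hx' := hne x hx
    field_simp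
    push_cast
    linear_combination (z * (((P n).eval x : ℝ) : ℂ)) * hev
  set S := ∫ x, (P n).eval x ^ 2 ∂μ with hS
  have hlow : 1 / 2 * S ≤ ‖∫ x : ℝ, (((P n).eval x ^ 2 : ℝ) : ℂ) * (z / (z - x)) ∂μ‖ := by
    refine le_trans ?_ (Complex.re_le_norm _)
    rw [← Complex.reCLM_apply, ← ContinuousLinearMap.integral_comp_comm _ i1, hS,
      ← integral_const_mul]
    refine integral_mono_ae ((integrable_polynomial_sq hB _).const_mul _)
      (Complex.reCLM.integrable_comp i1) ?_
    filter_upwards [hae] with x hx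
    have hx1 : |x| < ‖z‖ := (abs_le.2 hx).trans_lt hz
    have := half_le_re_div_sub hx1
    simp only [Complex.reCLM_apply, Complex.re_ofReal_mul]
    nlinarith [sq_nonneg ((P n).eval x)]
  have ht : 0 < √S := Real.sqrt_pos.2 hpos
  have hM0 : μ ≠ 0 := by
    rintro rfl
    simp [hS] at hpos
  have hMn : 0 ≤ M := by
    have : NeBot (ae μ) := ae_neBot.2 hM0
    obtain ⟨x, hx⟩ := hM.exists
    exact (abs_nonneg _).trans hx
  have hzB : 0 < ‖z‖ - B := by linarith
  have hup : ‖∫ x : ℝ, (((P n).eval x * r.eval x : ℝ) : ℂ) * (z / (z - x)) ∂μ‖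
      ≤ M * (‖z‖ / (‖z‖ - B)) * ((1 + μ.real univ) / 2 * √S) := by
    have hi : Integrable (fun x => M * (‖z‖ / (‖z‖ - B))
        * (1 / 2 * (√S + (√S)⁻¹ * (P n).eval x ^ 2))) μ :=
      integrable_of_continuous_of_compl_Icc hB (by fun_prop)
    refine (norm_integral_le_of_norm_le hi ?_).trans ?_
    · filter_upwards [hae, hM] with x hx hrx
      rw [norm_mul, Complex.norm_real, norm_div, Real.norm_eq_abs, abs_mul]
      have hx1 : |x| ≤ B := abs_le.2 hx
      have h2 : ‖z‖ - B ≤ ‖z - x‖ := by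
        have : ‖z‖ - |x| ≤ ‖z - x‖ := by simpa using norm_sub_norm_le z (x : ℂ)
        linarith
      -- The arithmetic-geometric mean inequality takes the place of Cauchy-Schwarz; it integrates
      -- to `√S` times (1 + μ(ℝ)) / 2.
      have h3 : |(P n).eval x| ≤ 1 / 2 * (√S + (√S)⁻¹ * (P n).eval x ^ 2) := by
        rw [← sq_abs ((P n).eval x)]
        set a := |(P n).eval x|
        have : a = 1 / 2 * (√S + (√S)⁻¹ * a ^ 2) - 1 / 2 * (√S)⁻¹ * (√S - a) ^ 2 := by
          field_simp; ring
        have h' : 0 ≤ 1 / 2 * (√S)⁻¹ * (√S - a) ^ 2 := by positivity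
        linarith
      calc |(P n).eval x| * |r.eval x| * (‖z‖ / ‖z - x‖)
          ≤ (1 / 2 * (√S + (√S)⁻¹ * (P n).eval x ^ 2)) * M * (‖z‖ / (‖z‖ - B)) := by gcongr
        _ = _ := by ring
    · rw [integral_const_mul, integral_const_mul, integral_add (integrable_const _)
        ((integrable_polynomial_sq hB _).const_mul _), integral_const_mul, ← hS]
      have : (√S)⁻¹ * S = √S := by
        rw [inv_mul_eq_div, Real.div_sqrt]
      rw [this]
      refine le_of_eq ?_
      simp only [integral_const, smul_eq_mul]
      ring
  have hfin : ‖q.eval z‖ * (1 / 2 * S)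
      ≤ ‖p.eval z‖ * (M * (‖z‖ / (‖z‖ - B)) * ((1 + μ.real univ) / 2 * √S)) := by
    calc ‖q.eval z‖ * (1 / 2 * S)
        ≤ ‖q.eval z‖ * ‖∫ x : ℝ, (((P n).eval x ^ 2 : ℝ) : ℂ) * (z / (z - x)) ∂μ‖ := by gcongr
      _ = ‖p.eval z‖ * ‖∫ x : ℝ, (((P n).eval x * r.eval x : ℝ) : ℂ) * (z / (z - x)) ∂μ‖ := by
          rw [← norm_mul, ident, norm_mul]
      _ ≤ _ := by gcongr
  have hSS : S = √S * √S := (Real.mul_self_sqrt hpos.le).symm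
  refine le_of_mul_le_mul_right ?_ ht
  calc ‖q.eval z‖ * √S * √S = 2 * (‖q.eval z‖ * (1 / 2 * S)) := by
        conv_rhs => rw [hSS]
        ring
    _ ≤ 2 * (‖p.eval z‖ * (M * (‖z‖ / (‖z‖ - B)) * ((1 + μ.real univ) / 2 * √S))) := by gcongr
    _ = _ := by ring

end CauchyBound

/-! ### Monic polynomials of nearly minimal size -/

section Chebyshev

lemma exists_equilibrium_and_fekete_prod {D : ℝ} (hD : 0 < D) {K : Set ℝ} (hK : IsCompact K)
    (hKD : ∀ x ∈ K, ∀ y ∈ K, |x - y| ≤ D) (hfin : minEnergy D K ≠ ⊤) :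
    ∃ (τ : ProbabilityMeasure ℝ) (U : Ultrafilter ℕ) (y : ∀ n : ℕ, Fin (n + 1) → ℝ),
      (τ : Measure ℝ) Kᶜ = 0 ∧ scaledEnergy D τ = minEnergy D K ∧ (∀ n i, y n i ∈ K) ∧
      Tendsto (fun n : ℕ => empirical (y n)) U (𝓝 τ) ∧
      ∀ ε > 0, ∀ᶠ n : ℕ in (U : Filter ℕ), ∀ z ∈ K,
        ∏ i, |z - y n i| ≤ (D * Real.exp (-(minEnergy D K).toReal + ε)) ^ (n + 1) := by
  obtain ⟨τ, U, y, hτK, hτ, -, hyK, hlim, hc⟩ := exists_equilibrium_and_fekete hK hfin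
  refine ⟨τ, U, y, hτK, hτ, hyK, hlim, fun ε hε => ?_⟩
  set w := (minEnergy D K).toReal
  have hw : minEnergy D K = ENNReal.ofReal w := (ENNReal.ofReal_toReal hfin).symm
  have key : ∀ᶠ n : ℕ in (U : Filter ℕ), ∀ z ∈ K,
      -- If `w - ε ≤ 0` the left side is zero, and the bound on Fekete sums is not needed.
      ENNReal.ofReal (((n : ℝ) + 1) * (w - ε)) ≤ ∑ i, scaledKernel D z (y n i) := by
    rcases le_or_gt (w - ε) 0 with h | h
    · refine Eventually.of_forall fun n z _ => ?_
      rw [ENNReal.ofReal_of_nonpos (mul_nonpos_of_nonneg_of_nonpos (by positivity) h)]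
      exact bot_le
    · have hlt : ENNReal.ofReal (w - ε) < minEnergy D K := by
        rw [hw]
        exact (ENNReal.ofReal_lt_ofReal_iff (by linarith)).2 (by linarith)
      filter_upwards [hc _ hlt] with n hn z hz
      rw [ENNReal.ofReal_mul (by positivity), ENNReal.ofReal_add (by positivity) (by norm_num)]
      simpa using hn z hz
  filter_upwards [key] with n hn z hz
  refine (prod_abs_sub_le hD Finset.univ (y n) z _ (fun i _ => hKD z hz _ (hyK n i))
    (hn z hz)).trans_eq ?_
  rw [Finset.card_univ, Fintype.card_fin, mul_pow, ← Real.exp_nat_mul]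
  congr 2
  push_cast
  ring

/-- There are monic polynomials of every degree which are as small on `K` as its capacity
allows, up to a subexponential factor. -/
lemma exists_monic_abs_eval_le {D : ℝ} (hD : 0 < D) {K : Set ℝ} (hK : IsCompact K)
    (hKD : ∀ x ∈ K, ∀ y ∈ K, |x - y| ≤ D) (hfin : minEnergy D K ≠ ⊤) {ε : ℝ} (hε : 0 < ε) :
    ∃ A : ℝ, 0 < A ∧ ∀ n : ℕ, ∃ R : ℝ[X], R.Monic ∧ R.natDegree = n ∧
      ∀ z ∈ K, |R.eval z| ≤ A * (D * Real.exp (-(minEnergy D K).toReal + ε)) ^ n := by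
  obtain ⟨τ, U, y, -, -, -, -, hprod⟩ := exists_equilibrium_and_fekete_prod hD hK hKD hfin
  obtain ⟨n₀, hn₀⟩ := (hprod ε hε).exists
  obtain ⟨b, hb⟩ := hK.exists_bound_of_continuousOn (f := fun x : ℝ => x) continuousOn_id
  set g := D * Real.exp (-(minEnergy D K).toReal + ε) with hg
  have hgpos : 0 < g := by positivity
  set m := n₀ + 1 with hm
  set F : ℝ[X] := ∏ i, (Polynomial.X - Polynomial.C (y n₀ i)) with hF
  have hFm : F.Monic := Polynomial.monic_prod_X_sub_C _ _
  have hFd : F.natDegree = m := by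
    simp [hF, hm, Polynomial.natDegree_prod_of_monic, Polynomial.monic_X_sub_C]
  have hFK : ∀ z ∈ K, |F.eval z| ≤ g ^ m := by
    intro z hz
    have : |F.eval z| = ∏ i, |z - y n₀ i| := by
      simp [hF, Polynomial.eval_prod, Finset.abs_prod]
    rw [this]
    exact hn₀ z hz
  -- One Fekete polynomial `F` of degree `m` serves all degrees, as `F ^ (n / m) * X ^ (n % m)`. The
  -- constant `b'` is such that |z| ≤ b' g on `K`, so the fewer than `m` extra factors cost at most
  -- `b' ^ m`.
  set b' := max 1 (b / g) with hb'
  have hb1 : 1 ≤ b' := le_max_left _ _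
  refine ⟨b' ^ m, by positivity, fun n => ⟨F ^ (n / m) * Polynomial.X ^ (n % m),
    (hFm.pow _).mul (Polynomial.monic_X_pow _), ?_, fun z hz => ?_⟩⟩
  · rw [(hFm.pow _).natDegree_mul (Polynomial.monic_X_pow _), hFm.natDegree_pow, hFd,
      Polynomial.natDegree_X_pow]
    exact Nat.div_add_mod' n m
  · have h1 : |z| ≤ b' * g := by
      have h2 : |z| ≤ b := hb z hz
      have h3 : b / g ≤ b' := le_max_right _ _
      rw [div_le_iff₀ hgpos] at h3
      linarith
    rw [Polynomial.eval_mul, Polynomial.eval_pow, Polynomial.eval_pow, Polynomial.eval_X, abs_mul,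
      abs_pow, abs_pow]
    calc |F.eval z| ^ (n / m) * |z| ^ (n % m) ≤ (g ^ m) ^ (n / m) * (b' * g) ^ (n % m) := by
          gcongr
          exact hFK z hz
      _ = b' ^ (n % m) * g ^ n := by
          conv_rhs => rw [← Nat.div_add_mod n m, pow_add, pow_mul]
          rw [mul_pow, Nat.mul_add_mod, Nat.mod_mod]
          ring
      _ ≤ b' ^ m * g ^ n := by
          gcongr
          exact (Nat.mod_lt _ (by omega)).le

end Chebyshev

/-! ### Regular measures: zero distribution and subexponential growth -/

section RegularMeasures

lemma log_norm_aeval_prod {n : ℕ} (y : Fin (n + 1) → ℝ) {z : ℂ} (hz : ∀ i, 0 < ‖z - y i‖) :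
    Real.log ‖Polynomial.aeval z (∏ i, (Polynomial.X - Polynomial.C (y i)))‖
      = ((n : ℝ) + 1) * ∫ t : ℝ, Real.log ‖z - t‖ ∂(empirical y : Measure ℝ) := by
  rw [integral_empirical, map_prod, norm_prod, Real.log_prod fun i _ => ?_]
  · have : (n : ℝ) + 1 ≠ 0 := by positivity
    rw [mul_inv_cancel_left₀ this]
    simp
  · simpa using (hz i).ne'

/-- The zeros of the orthogonal polynomials of a regular measure are asymptotically distributed
like those of Fekete polynomials: comparison of the logarithmic potentials. -/
lemma integral_log_le_of_tendsto {μ : Measure ℝ} [IsFiniteMeasure μ] {B D w : ℝ} (hD : 0 < D)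
    (hB : μ (Icc (-B) B)ᶜ = 0) {K : Set ℝ} (hμK : μ Kᶜ = 0)
    (hdef : ∀ p : ℝ[X], p ≠ 0 → 0 < ∫ x, p.eval x ^ 2 ∂μ)
    {P : ℕ → ℝ[X]} (hP : IsMonicOrthogonal μ P)
    (hlim : Tendsto (fun n : ℕ => Real.log (√(∫ x, (P n).eval x ^ 2 ∂μ)) / n) atTop
      (𝓝 (Real.log D - w)))
    {z : ℂ} (hz : B < ‖z‖) {V : Filter ℕ} [V.NeBot] (hV : V ≤ atTop) {u : ℝ}
    (hu : Tendsto (fun n : ℕ => Real.log ‖Polynomial.aeval z (P n)‖ / n) V (𝓝 u))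
    (hPz : ∀ n, 0 < ‖Polynomial.aeval z (P n)‖)
    {F : ℝ[X]} {m : ℕ} (hm : 0 < m) (hFd : F.natDegree = m)
    (hFz : 0 < ‖Polynomial.aeval z F‖) {ε : ℝ}
    (hFK : ∀ x ∈ K, |F.eval x| ≤ (D * Real.exp (-w + ε)) ^ m) :
    Real.log ‖Polynomial.aeval z F‖ / m ≤ u + ε := by
  set g := D * Real.exp (-w + ε) with hg
  have hgpos : 0 < g := by positivity
  have hlogg : Real.log g = Real.log D - w + ε := by
    rw [hg, Real.log_mul hD.ne' (Real.exp_pos _).ne', Real.log_exp]; ring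
  have hae : ∀ᵐ x ∂μ, x ∈ K := by rwa [ae_iff]
  have hm' : (0 : ℝ) < m := by exact_mod_cast hm
  set c := ‖z‖ / (‖z‖ - B) * (1 + μ.real univ) with hc
  have hs : ∀ n, 0 < √(∫ x, (P n).eval x ^ 2 ∂μ) := fun n =>
    Real.sqrt_pos.2 (hdef _ (hP.monic n).ne_zero)
  -- The comparison bound for `F ^ (n / m)`, of degree at most `n`. Taking logarithms, dividing by
  -- `n` and letting `n` grow, regularity cancels the terms in `log D - w` and only `ε` survives.
  have key : ∀ n : ℕ, ‖Polynomial.aeval z F‖ ^ (n / m) * √(∫ x, (P n).eval x ^ 2 ∂μ)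
      ≤ c * (‖Polynomial.aeval z (P n)‖ * (g ^ m) ^ (n / m)) := by
    intro n
    have := norm_aeval_mul_le hB hP (n := n) hz (hdef _ (hP.monic n).ne_zero) (r := F ^ (n / m))
      (M := (g ^ m) ^ (n / m)) (by
        refine Polynomial.natDegree_pow_le.trans ?_
        rw [hFd]
        exact Nat.div_mul_le_self n m) (by
        filter_upwards [hae] with x hx
        rw [Polynomial.eval_pow, abs_pow]
        gcongr
        exact hFK x hx)
    rwa [map_pow, norm_pow] at this
  have hcpos : 0 < c := by
    have h1 := key 0
    have h2 : 0 < ‖Polynomial.aeval z F‖ ^ (0 / m) * √(∫ x, (P 0).eval x ^ 2 ∂μ) :=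
      mul_pos (pow_pos hFz _) (hs 0)
    exact pos_of_mul_pos_left (h2.trans_le h1) (by positivity)
  have key2 : ∀ n : ℕ, 0 < n → ((n / m : ℕ) : ℝ) / n * (Real.log ‖Polynomial.aeval z F‖
      - m * Real.log g) + Real.log (√(∫ x, (P n).eval x ^ 2 ∂μ)) / n
      ≤ Real.log c / n + Real.log ‖Polynomial.aeval z (P n)‖ / n := by
    intro n hn
    have hn' : (0 : ℝ) < n := by exact_mod_cast hn
    have h := Real.log_le_log (mul_pos (pow_pos hFz _) (hs n)) (key n)
    rw [Real.log_mul (pow_pos hFz _).ne' (hs n).ne', Real.log_mul hcpos.ne'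
      (mul_pos (hPz n) (by positivity)).ne', Real.log_mul (hPz n).ne' (by positivity),
      Real.log_pow, Real.log_pow, Real.log_pow] at h
    rw [div_mul_eq_mul_div, ← add_div, ← add_div]
    exact div_le_div_of_nonneg_right (by linarith) hn'.le
  have hk : Tendsto (fun n : ℕ => ((n / m : ℕ) : ℝ) / n) atTop (𝓝 (1 / m)) := by
    have := (tendsto_nat_floor_mul_div_atTop (R := ℝ) (a := 1 / m) (by positivity)).comp
      tendsto_natCast_atTop_atTop
    refine this.congr fun n => ?_
    simp only [Function.comp]
    rw [one_div_mul_eq_div, Nat.floor_div_eq_div]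
  have hcn : Tendsto (fun n : ℕ => Real.log c / n) atTop (𝓝 0) :=
    tendsto_const_div_atTop_nhds_zero_nat _
  have hL := ((hk.mul_const (Real.log ‖Polynomial.aeval z F‖ - m * Real.log g)).add hlim).mono_left
    hV
  have hR := (hcn.mono_left hV).add hu
  have hle := le_of_tendsto_of_tendsto hL hR (by
    filter_upwards [hV (eventually_gt_atTop 0)] with n hn using key2 n hn)
  rw [hlogg] at hle
  have e : 1 / (m : ℝ) * (Real.log ‖Polynomial.aeval z F‖ - m * (Real.log D - w + ε))
      = Real.log ‖Polynomial.aeval z F‖ / m - (Real.log D - w + ε) := by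
    field_simp
  rw [e] at hle
  linarith

/-- For a regular measure, the orthonormal polynomials grow subexponentially wherever the
equilibrium potential attains its maximal value. -/
theorem eventually_abs_eval_le_of_regular {μ : Measure ℝ} [IsFiniteMeasure μ] {B D : ℝ}
    (hB0 : 0 < B) (hD : 2 * B ≤ D)
    (hB : μ (Icc (-B) B)ᶜ = 0) {K : Set ℝ} (hKB : K ⊆ Icc (-B) B)
    (hμK : μ Kᶜ = 0) (hfin : minEnergy D K ≠ ⊤)
    (hdef : ∀ p : ℝ[X], p ≠ 0 → 0 < ∫ x, p.eval x ^ 2 ∂μ)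
    {P : ℕ → ℝ[X]} (hP : IsMonicOrthogonal μ P)
    (hlim : Tendsto (fun n : ℕ => Real.log (√(∫ x, (P n).eval x ^ 2 ∂μ)) / n) atTop
      (𝓝 (Real.log D - (minEnergy D K).toReal)))
    {τ : ProbabilityMeasure ℝ} {U : Ultrafilter ℕ} {y : ∀ n : ℕ, Fin (n + 1) → ℝ}
    (hτK : (τ : Measure ℝ) Kᶜ = 0) (hyK : ∀ n i, y n i ∈ K)
    (hyτ : Tendsto (fun n : ℕ => empirical (y n)) U (𝓝 τ))
    (hy : ∀ ε > 0, ∀ᶠ n : ℕ in (U : Filter ℕ), ∀ z ∈ K,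
        ∏ i, |z - y n i| ≤ (D * Real.exp (-(minEnergy D K).toReal + ε)) ^ (n + 1))
    {x : ℝ} (hx : x ∈ Icc (-B) B) (hxτ : minEnergy D K ≤ scaledPotential D τ x)
    {ε : ℝ} (hε : 0 < ε) :
    ∀ᶠ n : ℕ in atTop,
      |(P n).eval x| ≤ Real.exp (ε * n) * √(∫ t, (P n).eval t ^ 2 ∂μ) := by
  have hD0 : 0 < D := by linarith
  set w := (minEnergy D K).toReal with hw
  have hs : ∀ n, 0 < √(∫ x, (P n).eval x ^ 2 ∂μ) := fun n =>
    Real.sqrt_pos.2 (hdef _ (hP.monic n).ne_zero)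
  -- The shift makes the degree positive, as `empirical` takes n + 1 points.
  rw [← Filter.map_add_atTop_eq_nat 1, eventually_map]
  by_contra hcon
  rw [not_eventually] at hcon
  have hne : (atTop ⊓ 𝓟 {n : ℕ | ¬ |(P (n + 1)).eval x|
      ≤ Real.exp (ε * (n + 1 : ℕ)) * √(∫ t, (P (n + 1)).eval t ^ 2 ∂μ)}).NeBot :=
    Filter.frequently_mem_iff_neBot.1 hcon
  obtain ⟨V, hV⟩ := Ultrafilter.exists_le (f := atTop ⊓ 𝓟 {n : ℕ |
    ¬ |(P (n + 1)).eval x| ≤ Real.exp (ε * (n + 1 : ℕ)) * √(∫ t, (P (n + 1)).eval t ^ 2 ∂μ)})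
  have hVtop : (V : Filter ℕ) ≤ atTop := hV.trans inf_le_left
  have hVbad : ∀ᶠ n in (V : Filter ℕ), Real.exp (ε * (n + 1 : ℕ))
      * √(∫ t, (P (n + 1)).eval t ^ 2 ∂μ) < |(P (n + 1)).eval x| := by
    have := le_principal_iff.1 (hV.trans inf_le_right)
    filter_upwards [this] with n hn using not_le.1 hn
  choose y' hy'B hy' using fun n => hP.exists_eq_prod hB0.le hB hdef (n + 1)
  have hemp : ∀ n, (empirical (y' n) : Measure ℝ) (Icc (-B) B)ᶜ = 0 := fun n =>
    empirical_compl_eq_zero (hy'B n)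
  obtain ⟨σ, hσB, hσ⟩ := exists_tendsto_of_compl_eq_zero isCompact_Icc V
    (ρs := fun n : ℕ => empirical (y' n)) hemp
  have hτB : (τ : Measure ℝ) (Icc (-B) B)ᶜ = 0 :=
    measure_mono_null (compl_subset_compl.2 hKB) hτK
  -- Each good Fekete polynomial of `K` is compared with the whole sequence `P n` along `V`; only
  -- then does its own degree go to infinity along `U`.
  have hpot : ∀ z : ℂ, B < ‖z‖ →
      ∫ t : ℝ, Real.log ‖z - t‖ ∂(τ : Measure ℝ) ≤ ∫ t : ℝ, Real.log ‖z - t‖ ∂(σ : Measure ℝ) := by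
    intro z hz
    have hcont := continuousOn_log_norm_sub hz
    have hPz : ∀ n, 0 < ‖Polynomial.aeval z (P n)‖ := by
      intro n
      obtain ⟨t, ht, htP⟩ := hP.exists_eq_prod hB0.le hB hdef n
      rw [htP, map_prod, norm_prod]
      refine Finset.prod_pos fun i _ => ?_
      simpa using sub_pos_of_mem_Icc hz (ht i)
    have hu : Tendsto (fun n : ℕ => Real.log ‖Polynomial.aeval z (P n)‖ / n)
        (Filter.map (fun n => n + 1) (V : Filter ℕ))
        (𝓝 (∫ t : ℝ, Real.log ‖z - t‖ ∂(σ : Measure ℝ))) := by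
      rw [tendsto_map'_iff]
      refine (tendsto_integral_of_continuousOn_Icc hσ hB0.le hemp hσB hcont).congr fun n => ?_
      simp only [Function.comp]
      rw [hy' n, log_norm_aeval_prod _ fun i => sub_pos_of_mem_Icc hz (hy'B n i)]
      have : (n : ℝ) + 1 ≠ 0 := by positivity
      push_cast
      rw [mul_div_cancel_left₀ _ this]
    have hV1 : Filter.map (fun n => n + 1) (V : Filter ℕ) ≤ atTop :=
      (Filter.map_mono hVtop).trans (Filter.map_add_atTop_eq_nat 1).le
    have hlim2 := tendsto_integral_of_continuousOn_Icc hyτ hB0.le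
      (fun n => empirical_compl_eq_zero fun i => hKB (hyK n i)) hτB hcont
    refine le_of_forall_pos_le_add fun δ hδ => ?_
    refine le_of_tendsto hlim2 ?_
    filter_upwards [hy δ hδ] with n hn
    have hzy : ∀ i, 0 < ‖z - y n i‖ := fun i => sub_pos_of_mem_Icc hz (hKB (hyK n i))
    have h := integral_log_le_of_tendsto hD0 hB hμK hdef hP hlim hz hV1 hu hPz
      (F := ∏ i, (Polynomial.X - Polynomial.C (y n i))) (m := n + 1) (by omega)
      (by simp [Polynomial.natDegree_prod_of_monic, Polynomial.monic_X_sub_C])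
      (by
        rw [map_prod, norm_prod]
        refine Finset.prod_pos fun i _ => ?_
        simpa using hzy i) (ε := δ)
      (by
        intro t ht
        have : |(∏ i, (Polynomial.X - Polynomial.C (y n i))).eval t| = ∏ i, |t - y n i| := by
          simp [Polynomial.eval_prod, Finset.abs_prod]
        rw [this]
        exact hn t ht)
    rw [log_norm_aeval_prod _ hzy] at h
    have h1 : (n : ℝ) + 1 ≠ 0 := by positivity
    push_cast at h
    rwa [mul_div_cancel_left₀ _ h1] at h
  have hστ : (σ : Measure ℝ) = τ := eq_of_forall_integral_log_le hB0 hσB hτB hpot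
  -- Half of `ε` pays for the norm asymptotics. The other half puts the zero distributions'
  -- potential at `x` below `w - ε / 2`, and descent passes this to `τ`, against `hxτ`.
  have hlow : ∀ᶠ n : ℕ in (V : Filter ℕ), D ^ (n + 1) * Real.exp (-(((n : ℝ) + 1) * (w - ε / 2)))
      < |(P (n + 1)).eval x| := by
    have h1 : ∀ᶠ n : ℕ in atTop, Real.log D - w - ε / 2
        < Real.log (√(∫ t, (P (n + 1)).eval t ^ 2 ∂μ)) / ((n + 1 : ℕ) : ℝ) :=
      (hlim.comp (tendsto_add_atTop_nat 1)).eventually_const_lt (by linarith)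
    filter_upwards [hVbad, hVtop h1] with n hn hn1
    refine lt_of_lt_of_le ?_ hn.le
    have hn0 : (0 : ℝ) < (n + 1 : ℕ) := by positivity
    rw [lt_div_iff₀ hn0] at hn1
    rw [← Real.exp_log (hs (n + 1)), ← Real.exp_log hD0, ← Real.exp_nat_mul, ← Real.exp_add,
      ← Real.exp_add]
    apply Real.exp_lt_exp.2
    push_cast at hn1 ⊢
    linarith
  -- The nonvanishing is recorded because it yields `w - ε / 2 > 0`, needed to remove
  -- `ENNReal.ofReal` at the end.
  have hpotn : ∀ᶠ n : ℕ in (V : Filter ℕ), ENNReal.ofReal (((n : ℝ) + 1) * (w - ε / 2)) ≠ 0 ∧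
      scaledPotential D (empirical (y' n) : Measure ℝ) x ≤ ENNReal.ofReal (w - ε / 2) := by
    filter_upwards [hlow] with n hn
    have h1 : ∑ i, scaledKernel D x (y' n i) < ENNReal.ofReal (((n : ℝ) + 1) * (w - ε / 2)) := by
      by_contra hge
      have h2 := prod_abs_sub_le hD0 Finset.univ (y' n) x _ (fun i _ => by
        have h3 := hy'B n i
        rw [abs_le]
        constructor <;> linarith [h3.1, h3.2, hx.1, hx.2]) (not_lt.1 hge)
      have h3 : |(P (n + 1)).eval x| = ∏ i, |x - y' n i| := by
        rw [hy' n]; simp [Polynomial.eval_prod, Finset.abs_prod]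
      rw [← h3, Finset.card_univ, Fintype.card_fin] at h2
      exact absurd hn (not_lt.2 h2)
    refine ⟨(pos_of_gt h1).ne', ?_⟩
    rw [scaledPotential, lintegral_empirical]
    have hN : ((n : ℝ≥0∞) + 1) ≠ 0 := by simp
    have hN' : ((n : ℝ≥0∞) + 1) ≠ ⊤ := by finiteness
    rw [ENNReal.inv_mul_le_iff hN hN']
    refine h1.le.trans_eq ?_
    rw [ENNReal.ofReal_mul (by positivity), ENNReal.ofReal_add (by positivity) (by norm_num)]
    simp
  obtain ⟨n, hn, -⟩ := hpotn.exists
  have hwε : 0 < w - ε / 2 := by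
    have h1 : 0 < ((n : ℝ) + 1) * (w - ε / 2) := by
      rw [← ENNReal.ofReal_pos]; exact pos_iff_ne_zero.2 hn
    exact pos_of_mul_pos_right h1 (by positivity)
  have h1 := scaledPotential_le_of_tendsto hσ (D := D) (x := x) (hpotn.mono fun n hn => hn.2)
  rw [hστ] at h1
  have h2 := hxτ.trans h1
  rw [← ENNReal.ofReal_toReal hfin, ENNReal.ofReal_le_ofReal_iff hwε.le] at h2
  linarith

end RegularMeasures

/-! ### Restriction to an interval -/

section Restriction

lemma minEnergy_anti (D : ℝ) {K L : Set ℝ} (h : L ⊆ K) : minEnergy D K ≤ minEnergy D L :=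
  le_iInf₂ fun ρ hρ => le_iInf fun h0 =>
    iInf₂_le_of_le ρ hρ (iInf_le _ (measure_mono_null (compl_subset_compl.2 h) h0))

lemma logCapacity_eq_ofReal {D : ℝ} (hD : 1 ≤ D) {K : Set ℝ}
    (hK : ∀ x ∈ K, ∀ y ∈ K, |x - y| ≤ D) (hfin : minEnergy D K ≠ ⊤) :
    logCapacity K = ENNReal.ofReal (D * Real.exp (-(minEnergy D K).toReal)) := by
  rw [logCapacity_eq hD hK, ← EReal.coe_ennreal_toReal hfin, ← EReal.coe_sub, EReal.exp_coe,
    sub_eq_add_neg, Real.exp_add, Real.exp_log (by linarith)]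

lemma minEnergy_ne_top {D : ℝ} (hD : 1 ≤ D) {K : Set ℝ}
    (hK : ∀ x ∈ K, ∀ y ∈ K, |x - y| ≤ D) (h : 0 < logCapacity K) : minEnergy D K ≠ ⊤ := by
  intro htop
  rw [logCapacity_eq hD hK, htop] at h
  simp at h

lemma tendsto_ofReal_rpow_iff {s : ℕ → ℝ} (hs : ∀ n, 0 < s n) {g : ℝ} (hg : 0 < g) :
    Tendsto (fun n : ℕ => ENNReal.ofReal (s n) ^ (1 / (n : ℝ))) atTop (𝓝 (ENNReal.ofReal g)) ↔
      Tendsto (fun n : ℕ => Real.log (s n) / n) atTop (𝓝 (Real.log g)) := by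
  -- At `n = 0` both sides are `1`, since division by zero gives exponent `0`.
  have e : ∀ n : ℕ, ENNReal.ofReal (s n) ^ (1 / (n : ℝ))
      = ENNReal.ofReal (Real.exp (Real.log (s n) / n)) := by
    intro n
    rw [ENNReal.ofReal_rpow_of_pos (hs n), Real.rpow_def_of_pos (hs n), mul_one_div]
  simp_rw [e]
  constructor
  · intro h
    have h1 := (ENNReal.tendsto_toReal ENNReal.ofReal_ne_top).comp h
    rw [ENNReal.toReal_ofReal hg.le] at h1
    have h2 := h1.log hg.ne'
    refine h2.congr fun n => ?_
    simp only [Function.comp]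
    rw [ENNReal.toReal_ofReal (Real.exp_pos _).le, Real.log_exp]
  · intro h
    have h1 := (Real.continuous_exp.tendsto _).comp h
    rw [Real.exp_log hg] at h1
    exact (ENNReal.continuous_ofReal.tendsto _).comp h1

/-- The norms of monic orthogonal polynomials are asymptotically at most the capacity. -/
lemma eventually_log_norm_div_lt {ν : Measure ℝ} [IsFiniteMeasure ν] {B D : ℝ} (hD : 0 < D)
    (hB : ν (Icc (-B) B)ᶜ = 0) {K : Set ℝ} (hK : IsCompact K)
    (hKD : ∀ x ∈ K, ∀ y ∈ K, |x - y| ≤ D) (hfin : minEnergy D K ≠ ⊤) (hνK : ν Kᶜ = 0)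
    (hdef : ∀ p : ℝ[X], p ≠ 0 → 0 < ∫ x, p.eval x ^ 2 ∂ν)
    {Q : ℕ → ℝ[X]} (hQ : IsMonicOrthogonal ν Q) {ε : ℝ} (hε : 0 < ε) :
    ∀ᶠ n : ℕ in atTop, Real.log (√(∫ x, (Q n).eval x ^ 2 ∂ν)) / n
      < Real.log D - (minEnergy D K).toReal + ε := by
  obtain ⟨A, hA, hR⟩ := exists_monic_abs_eval_le hD hK hKD hfin (half_pos hε)
  set w := (minEnergy D K).toReal
  set g := D * Real.exp (-w + ε / 2) with hg
  have hgpos : 0 < g := by positivity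
  have hlogg : Real.log g = Real.log D - w + ε / 2 := by
    rw [hg, Real.log_mul hD.ne' (Real.exp_pos _).ne', Real.log_exp]; ring
  set A' := A * √(1 + ν.real univ) with hA'
  have hA'pos : 0 < A' := by positivity
  have hae : ∀ᵐ x ∂ν, x ∈ K := by rwa [ae_iff]
  have hbound : ∀ n : ℕ, √(∫ x, (Q n).eval x ^ 2 ∂ν) ≤ A' * g ^ n := by
    intro n
    obtain ⟨R, hRm, hRd, hRK⟩ := hR n
    rw [Real.sqrt_le_left (by positivity)]
    calc ∫ x, (Q n).eval x ^ 2 ∂ν ≤ ∫ x, R.eval x ^ 2 ∂ν := hQ.integral_sq_le hB hRm hRd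
      _ ≤ ∫ x, (A * g ^ n) ^ 2 ∂ν := by
          refine integral_mono_ae (integrable_polynomial_sq hB _) (integrable_const _) ?_
          filter_upwards [hae] with x hx
          exact sq_le_sq' (by linarith [abs_le.1 (hRK x hx)]) (abs_le.1 (hRK x hx)).2
      _ = (A * g ^ n) ^ 2 * ν.real univ := by simp [mul_comm]
      _ ≤ (A * g ^ n) ^ 2 * (1 + ν.real univ) := by gcongr; linarith
      _ = (A' * g ^ n) ^ 2 := by
          rw [hA', show (A * √(1 + ν.real univ) * g ^ n) ^ 2
            = (A * g ^ n) ^ 2 * √(1 + ν.real univ) ^ 2 by ring, Real.sq_sqrt (by positivity)]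
  have h0 : ∀ᶠ n : ℕ in atTop, Real.log A' / n < ε / 2 :=
    (tendsto_const_div_atTop_nhds_zero_nat _).eventually_lt_const (by linarith)
  filter_upwards [h0, eventually_gt_atTop 0] with n hn hn0
  have hn' : (0 : ℝ) < n := by exact_mod_cast hn0
  have h1 := Real.log_le_log (Real.sqrt_pos.2 (hdef _ (hQ.monic n).ne_zero)) (hbound n)
  rw [Real.log_mul hA'pos.ne' (by positivity), Real.log_pow, hlogg] at h1
  rw [div_lt_iff₀ hn'] at hn ⊢
  nlinarith

/-- Localization: a polynomial with small `L²` norm on `[a, b]` is, at an interior point of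
`[a, b]`, controlled by the orthonormal polynomials of the full measure. -/
lemma exists_localization_bound {μ : Measure ℝ} [IsFiniteMeasure μ] {B D : ℝ} (hB0 : 0 < B)
    (hD : 2 * B ≤ D) (hB : μ (Icc (-B) B)ᶜ = 0)
    (hdef : ∀ p : ℝ[X], p ≠ 0 → 0 < ∫ x, p.eval x ^ 2 ∂μ)
    {P : ℕ → ℝ[X]} (hP : IsMonicOrthogonal μ P) {a b x₀ : ℝ} (hx₀ : x₀ ∈ Ioo a b)
    (hx₀B : x₀ ∈ Icc (-B) B) {c : ℝ} (hc : 0 < c) :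
    ∃ k : ℕ, ∀ (n : ℕ) (y : Fin n → ℝ), (∀ i, y i ∈ Icc (-B) B) →
      √(∫ x, (∏ i, (Polynomial.X - Polynomial.C (y i)) : ℝ[X]).eval x ^ 2
        ∂(μ.restrict (Icc a b))) ≤ c ^ n →
      ∏ i, |x₀ - y i| ≤ √(1 + μ.real univ) * c ^ n
        * ∑ j ∈ Finset.range ((2 * k + 1) * n + 1),
          |(P j).eval x₀| / √(∫ t, (P j).eval t ^ 2 ∂μ) := by
  have hD0 : 0 < D := by linarith
  set d := min (x₀ - a) (b - x₀) with hd
  have hdpos : 0 < d := lt_min (by linarith [hx₀.1]) (by linarith [hx₀.2])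
  -- The bound for the peaking polynomial `W` off `[a, b]`. The maximum with `0` is needed because
  -- `[a, b]` is not assumed to lie in `[-B, B]`, so `d` may exceed `D`.
  set θ := max 0 (1 - d ^ 2 / D ^ 2) with hθ
  have hθ0 : 0 ≤ θ := le_max_left _ _
  have hθ1 : θ < 1 := max_lt one_pos (by
    have : 0 < d ^ 2 / D ^ 2 := by positivity
    linarith)
  -- With this `k`, the factor `W ^ (k * n)` brings the trivial bound `D ^ n` for `Q` off `[a, b]`
  -- down to `c ^ n`, while `W x₀ = 1` leaves the value at `x₀` unchanged.
  obtain ⟨k, hk⟩ : ∃ k : ℕ, θ ^ k * D ≤ c := by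
    obtain ⟨k, hk⟩ := exists_pow_lt_of_lt_one (div_pos hc hD0) hθ1
    exact ⟨k, by rw [lt_div_iff₀ hD0] at hk; exact hk.le⟩
  refine ⟨k, fun n y hy hsmall => ?_⟩
  set Q : ℝ[X] := ∏ i, (Polynomial.X - Polynomial.C (y i)) with hQ
  set W : ℝ[X] := 1 - Polynomial.C (1 / D ^ 2) * (Polynomial.X - Polynomial.C x₀) ^ 2 with hW
  have hWe : ∀ x, W.eval x = 1 - (x - x₀) ^ 2 / D ^ 2 := by
    intro x; simp [hW]; ring
  set R : ℝ[X] := Q * W ^ (k * n) with hR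
  have hQd : Q.natDegree = n := by
    simp [hQ, Polynomial.natDegree_prod_of_monic, Polynomial.monic_X_sub_C]
  have hWd : W.natDegree ≤ 2 := by
    refine (Polynomial.natDegree_sub_le _ _).trans (max_le (by simp) ?_)
    refine (Polynomial.natDegree_C_mul_le _ _).trans (Polynomial.natDegree_pow_le.trans ?_)
    rw [Polynomial.natDegree_X_sub_C]
  have hRd : R.degree < (((2 * k + 1) * n + 1 : ℕ) : WithBot ℕ) := by
    refine (Polynomial.degree_le_natDegree).trans_lt ?_
    have h1 : R.natDegree ≤ n + k * n * 2 := by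
      refine Polynomial.natDegree_mul_le.trans ?_
      rw [hQd]
      exact Nat.add_le_add_left (Polynomial.natDegree_pow_le.trans (Nat.mul_le_mul_left _ hWd)) _
    have h2 : R.natDegree < (2 * k + 1) * n + 1 := by
      have : (2 * k + 1) * n + 1 = n + k * n * 2 + 1 := by ring
      omega
    exact_mod_cast h2
  have hQabs : ∀ x, |Q.eval x| = ∏ i, |x - y i| := fun x => by
    simp [hQ, Polynomial.eval_prod, Finset.abs_prod]
  have hQle : ∀ x ∈ Icc (-B) B, |Q.eval x| ≤ D ^ n := by
    intro x hx
    rw [hQabs]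
    calc ∏ i, |x - y i| ≤ ∏ _i : Fin n, D := by
          refine Finset.prod_le_prod (fun i _ => abs_nonneg _) fun i _ => ?_
          have := hy i
          rw [abs_le]
          constructor <;> linarith [this.1, this.2, hx.1, hx.2]
      _ = D ^ n := by simp
  have hWle : ∀ x ∈ Icc (-B) B, |W.eval x| ≤ 1 := by
    intro x hx
    rw [hWe, abs_le]
    have h1 : (x - x₀) ^ 2 ≤ D ^ 2 := by
      apply sq_le_sq'
      · linarith [hx.1, hx₀B.2]
      · linarith [hx.2, hx₀B.1]
    have h2 : (x - x₀) ^ 2 / D ^ 2 ≤ 1 := (div_le_one (by positivity)).2 h1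
    have h3 : 0 ≤ (x - x₀) ^ 2 / D ^ 2 := by positivity
    constructor <;> linarith
  have hWθ : ∀ x ∈ Icc (-B) B, x ∉ Icc a b → |W.eval x| ≤ θ := by
    intro x hx hxI
    have h1 : d ≤ |x - x₀| := by
      by_contra hlt
      rw [not_le, abs_lt] at hlt
      apply hxI
      have h2 : d ≤ x₀ - a := min_le_left _ _
      have h3 : d ≤ b - x₀ := min_le_right _ _
      constructor <;> linarith [hlt.1, hlt.2]
    have h4 : d ^ 2 ≤ (x - x₀) ^ 2 := by
      rw [← sq_abs (x - x₀)]
      gcongr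
    have h5 : d ^ 2 / D ^ 2 ≤ (x - x₀) ^ 2 / D ^ 2 := by gcongr
    have h6 : 0 ≤ W.eval x := by
      rw [hWe]
      have h1 : (x - x₀) ^ 2 ≤ D ^ 2 := by
        apply sq_le_sq'
        · linarith [hx.1, hx₀B.2]
        · linarith [hx.2, hx₀B.1]
      have h2 : (x - x₀) ^ 2 / D ^ 2 ≤ 1 := (div_le_one (by positivity)).2 h1
      linarith
    rw [abs_of_nonneg h6, hWe]
    exact le_trans (by linarith) (le_max_right _ _)
  have hae : ∀ᵐ x ∂μ, x ∈ Icc (-B) B := by rwa [ae_iff]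
  have hint : ∀ p : ℝ[X], Integrable (fun x => p.eval x ^ 2) μ := integrable_polynomial_sq hB
  have hR2 : ∫ x, R.eval x ^ 2 ∂μ ≤ (√(1 + μ.real univ) * c ^ n) ^ 2 := by
    rw [← integral_add_compl (measurableSet_Icc (a := a) (b := b)) (hint R)]
    have h1 : ∫ x in Icc a b, R.eval x ^ 2 ∂μ ≤ (c ^ n) ^ 2 := by
      rw [Real.sqrt_le_left (by positivity)] at hsmall
      refine le_trans ?_ hsmall
      refine integral_mono_ae (hint R).integrableOn (hint Q).integrableOn ?_
      filter_upwards [ae_restrict_of_ae hae] with x hx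
      rw [sq_le_sq, hR, Polynomial.eval_mul, Polynomial.eval_pow, abs_mul, abs_pow]
      exact mul_le_of_le_one_right (abs_nonneg _) (pow_le_one₀ (abs_nonneg _) (hWle x hx))
    have h2 : ∫ x in (Icc a b)ᶜ, R.eval x ^ 2 ∂μ ≤ (c ^ n) ^ 2 * μ.real univ := by
      calc ∫ x in (Icc a b)ᶜ, R.eval x ^ 2 ∂μ ≤ ∫ x in (Icc a b)ᶜ, (c ^ n) ^ 2 ∂μ := by
            refine integral_mono_ae (hint R).integrableOn (integrable_const _) ?_
            filter_upwards [ae_restrict_of_ae hae,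
              ae_restrict_mem (measurableSet_Icc (a := a) (b := b)).compl] with x hx hxI
            rw [sq_le_sq, abs_of_nonneg (pow_nonneg hc.le n), hR, Polynomial.eval_mul,
              Polynomial.eval_pow, abs_mul, abs_pow]
            calc |Q.eval x| * |W.eval x| ^ (k * n) ≤ D ^ n * θ ^ (k * n) := by
                  gcongr
                  · exact hQle x hx
                  · exact hWθ x hx hxI
              _ = (θ ^ k * D) ^ n := by rw [mul_pow, ← pow_mul, mul_comm]
              _ ≤ c ^ n := by gcongr
        _ = (c ^ n) ^ 2 * μ.real (Icc a b)ᶜ := by simp [mul_comm]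
        _ ≤ (c ^ n) ^ 2 * μ.real univ := by gcongr; exact measure_ne_top _ _; exact subset_univ _
    rw [mul_pow, Real.sq_sqrt (by positivity)]
    linarith
  have hRx₀ : |R.eval x₀| = ∏ i, |x₀ - y i| := by
    rw [← hQabs, hR]
    simp [hWe]
  rw [← hRx₀]
  refine (hP.abs_eval_le hB hdef _ x₀ R hRd).trans ?_
  gcongr
  rw [Real.sqrt_le_left (by positivity)]
  exact hR2

lemma exists_le_of_eventually_le_exp {u : ℕ → ℝ} {δ : ℝ}
    (h : ∀ᶠ j : ℕ in atTop, u j ≤ Real.exp (δ * j)) :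
    ∃ A : ℝ, 0 < A ∧ ∀ j : ℕ, u j ≤ A * Real.exp (δ * j) := by
  obtain ⟨N, hN⟩ := eventually_atTop.1 h
  refine ⟨1 + ∑ i ∈ Finset.range N, |u i| / Real.exp (δ * i), ?_, fun j => ?_⟩
  · have : 0 ≤ ∑ i ∈ Finset.range N, |u i| / Real.exp (δ * i) :=
      Finset.sum_nonneg fun i _ => by positivity
    linarith
  · have hnn : 0 ≤ ∑ i ∈ Finset.range N, |u i| / Real.exp (δ * i) :=
      Finset.sum_nonneg fun i _ => by positivity
    have hexp := Real.exp_pos (δ * j)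
    by_cases hj : N ≤ j
    · have := hN j hj
      nlinarith
    · have h1 : |u j| / Real.exp (δ * j) ≤ ∑ i ∈ Finset.range N, |u i| / Real.exp (δ * i) :=
        Finset.single_le_sum (f := fun i : ℕ => |u i| / Real.exp (δ * i))
          (fun i _ => by positivity) (Finset.mem_range.2 (not_le.1 hj))
      rw [div_le_iff₀ hexp] at h1
      nlinarith [le_abs_self (u j)]

/-- If the orthonormal polynomials grow subexponentially at an interior point of `[a, b]`, then
so do the suitably normalized polynomials with small `L²` norm on `[a, b]`. -/
lemma eventually_prod_le_of_subexponential {μ : Measure ℝ} [IsFiniteMeasure μ] {B D : ℝ}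
    (hB0 : 0 < B) (hD : 2 * B ≤ D) (hB : μ (Icc (-B) B)ᶜ = 0)
    (hdef : ∀ p : ℝ[X], p ≠ 0 → 0 < ∫ x, p.eval x ^ 2 ∂μ)
    {P : ℕ → ℝ[X]} (hP : IsMonicOrthogonal μ P) {a b x₀ : ℝ} (hx₀ : x₀ ∈ Ioo a b)
    (hx₀B : x₀ ∈ Icc (-B) B)
    (hsub : ∀ δ > 0, ∀ᶠ n : ℕ in atTop,
      |(P n).eval x₀| ≤ Real.exp (δ * n) * √(∫ t, (P n).eval t ^ 2 ∂μ))
    {c : ℝ} (hc : 0 < c) {y : ∀ n, Fin n → ℝ} (hy : ∀ n i, y n i ∈ Icc (-B) B)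
    {ε : ℝ} (hε : 0 < ε) :
    ∀ᶠ n : ℕ in atTop,
      √(∫ x, (∏ i, (Polynomial.X - Polynomial.C (y n i)) : ℝ[X]).eval x ^ 2
        ∂(μ.restrict (Icc a b))) ≤ c ^ n →
      ∏ i, |x₀ - y n i| ≤ (c * Real.exp ε) ^ n := by
  obtain ⟨k, hk⟩ := exists_localization_bound hB0 hD hB hdef hP hx₀ hx₀B hc
  have hs : ∀ n, 0 < √(∫ x, (P n).eval x ^ 2 ∂μ) := fun n =>
    Real.sqrt_pos.2 (hdef _ (hP.monic n).ne_zero)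
  -- For N = (2k + 1) n + 1 terms the sum is at most a constant times e^(2δN), and 2δN = 2δ + εn/2.
  -- The remaining e^(εn/2) absorbs the constant `C`.
  set δ := ε / (4 * (2 * k + 1)) with hδ
  have hδpos : 0 < δ := by positivity
  obtain ⟨A, hA, hAj⟩ := exists_le_of_eventually_le_exp (δ := δ)
    (u := fun j : ℕ => |(P j).eval x₀| / √(∫ t, (P j).eval t ^ 2 ∂μ)) (by
      filter_upwards [hsub δ hδpos] with j hj
      rwa [div_le_iff₀ (hs j)])
  have hsum : ∀ N : ℕ, ∑ j ∈ Finset.range N, |(P j).eval x₀| / √(∫ t, (P j).eval t ^ 2 ∂μ)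
      ≤ A / δ * Real.exp (2 * δ * N) := by
    intro N
    calc ∑ j ∈ Finset.range N, |(P j).eval x₀| / √(∫ t, (P j).eval t ^ 2 ∂μ)
        ≤ ∑ _j ∈ Finset.range N, A * Real.exp (δ * N) := by
          refine Finset.sum_le_sum fun j hj => (hAj j).trans ?_
          have : (j : ℝ) ≤ N := by exact_mod_cast (Finset.mem_range.1 hj).le
          gcongr
      _ = N * (A * Real.exp (δ * N)) := by simp
      _ = A / δ * (δ * N * Real.exp (δ * N)) := by field_simp
      _ ≤ A / δ * (Real.exp (δ * N) * Real.exp (δ * N)) := by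
          gcongr
          linarith [Real.add_one_le_exp (δ * N)]
      _ = A / δ * Real.exp (2 * δ * N) := by rw [← Real.exp_add]; ring_nf
  set C := √(1 + μ.real univ) * (A / δ * Real.exp (2 * δ)) with hC
  have hev : ∀ᶠ n : ℕ in atTop, C ≤ Real.exp (ε / 2 * n) := by
    have : Tendsto (fun n : ℕ => Real.exp (ε / 2 * n)) atTop atTop :=
      Real.tendsto_exp_atTop.comp
        (tendsto_natCast_atTop_atTop.const_mul_atTop (by positivity))
    exact this.eventually_ge_atTop C
  filter_upwards [hev] with n hn hsmall
  refine (hk n (y n) (hy n) hsmall).trans ?_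
  calc √(1 + μ.real univ) * c ^ n * ∑ j ∈ Finset.range ((2 * k + 1) * n + 1),
          |(P j).eval x₀| / √(∫ t, (P j).eval t ^ 2 ∂μ)
      ≤ √(1 + μ.real univ) * c ^ n
        * (A / δ * Real.exp (2 * δ * ((2 * k + 1) * n + 1 : ℕ))) := by
        gcongr
        exact hsum _
    _ = C * (c ^ n * Real.exp (ε / 2 * n)) := by
        have : 2 * δ * (((2 * k + 1) * n + 1 : ℕ) : ℝ) = 2 * δ + ε / 2 * n := by
          rw [hδ]; push_cast; field_simp
          ring
        rw [this, Real.exp_add, hC]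
        ring
    _ ≤ Real.exp (ε / 2 * n) * (c ^ n * Real.exp (ε / 2 * n)) := by gcongr
    _ = (c * Real.exp ε) ^ n := by
        rw [mul_pow, ← Real.exp_nat_mul, mul_left_comm, ← Real.exp_add]
        congr 2
        ring

/-- The norms of the monic orthogonal polynomials of the restriction of a regular measure are
asymptotically at least the capacity. -/
lemma eventually_pow_le_norm_restrict {μ : Measure ℝ} [IsFiniteMeasure μ] {B D : ℝ}
    (hB0 : 0 < B) (hD : 2 * B ≤ D) (hB : μ (Icc (-B) B)ᶜ = 0)
    (hdef : ∀ p : ℝ[X], p ≠ 0 → 0 < ∫ x, p.eval x ^ 2 ∂μ)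
    {P : ℕ → ℝ[X]} (hP : IsMonicOrthogonal μ P) {K : Set ℝ} (hK : IsCompact K)
    (hKB : K ⊆ Icc (-B) B) (hμK : μ Kᶜ = 0)
    (hlim : Tendsto (fun n : ℕ => Real.log (√(∫ x, (P n).eval x ^ 2 ∂μ)) / n) atTop
      (𝓝 (Real.log D - (minEnergy D K).toReal)))
    {a b : ℝ} {L : Set ℝ} (hL : IsCompact L) (hLK : L ⊆ K) (hLab : L ⊆ Icc a b)
    (hLfin : minEnergy D L ≠ ⊤)
    (hdefν : ∀ p : ℝ[X], p ≠ 0 → 0 < ∫ x, p.eval x ^ 2 ∂(μ.restrict (Icc a b)))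
    {Q : ℕ → ℝ[X]} (hQ : IsMonicOrthogonal (μ.restrict (Icc a b)) Q) {ε : ℝ} (hε : 0 < ε) :
    ∀ᶠ n : ℕ in atTop, (D * Real.exp (-(minEnergy D L).toReal - ε)) ^ n
      ≤ √(∫ x, (Q n).eval x ^ 2 ∂(μ.restrict (Icc a b))) := by
  have hD0 : 0 < D := by linarith
  have hKD : ∀ x ∈ Icc (-B) B, ∀ y ∈ Icc (-B) B, |x - y| ≤ D := by
    intro x hx y hy
    rw [abs_le]
    constructor <;> linarith [hx.1, hx.2, hy.1, hy.2]
  have hKfin : minEnergy D K ≠ ⊤ := ne_top_of_le_ne_top hLfin (minEnergy_anti D hLK)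
  have hBν : μ.restrict (Icc a b) (Icc (-B) B)ᶜ = 0 :=
    Measure.absolutelyContinuous_of_le Measure.restrict_le_self hB
  obtain ⟨τ, U, y, hτK, hτ, hyK, hyτ, hy⟩ := exists_equilibrium_and_fekete_prod hD0 hK
    (fun x hx y hy => hKD x (hKB hx) y (hKB hy)) hKfin
  obtain ⟨ω, -, -, hωL, hω, -, -, -⟩ := exists_equilibrium_and_fekete_prod hD0 hL
    (fun x hx y hy => hKD x (hKB (hLK hx)) y (hKB (hLK hy))) hLfin
  set w := (minEnergy D L).toReal with hw
  set c := D * Real.exp (-w - ε) with hc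
  have hcpos : 0 < c := by positivity
  choose z hzB hz using fun n => hQ.exists_eq_prod hB0.le hBν hdefν n
  have hωfin : scaledEnergy D ω ≠ ⊤ := hω ▸ hLfin
  -- Since `ω` has finite energy, the lower Frostman bound for `τ` holds `ω`-almost everywhere, and
  -- the end points `a`, `b` carry no mass. At the remaining points localization applies, and c
  -- e^(ε/2) = D e^(-(w + ε/2)).
  have hgood : ∀ᵐ x ∂(ω : Measure ℝ), ∀ᶠ n : ℕ in atTop,
      √(∫ t, (Q n).eval t ^ 2 ∂(μ.restrict (Icc a b))) ≤ c ^ n →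
      ENNReal.ofReal (w + ε / 2) ≤ (n : ℝ≥0∞)⁻¹ * ∑ i, scaledKernel D x (z n i) := by
    have h1 := minEnergy_le_scaledPotential_ae hτK hτ hKfin
      (ρ := ω) (measure_mono_null (compl_subset_compl.2 hLK) hωL) hωfin
    have h2 : ∀ᵐ x ∂(ω : Measure ℝ), x ∈ L := by rwa [ae_iff]
    have h3 : ∀ t : ℝ, ∀ᵐ x ∂(ω : Measure ℝ), x ≠ t := fun t => by
      rw [ae_iff]
      simpa using noAtoms_of_scaledEnergy_ne_top hωfin t
    filter_upwards [h1, h2, h3 a, h3 b] with x hx hxL hxa hxb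
    have hxI : x ∈ Ioo a b :=
      ⟨lt_of_le_of_ne (hLab hxL).1 hxa.symm, lt_of_le_of_ne (hLab hxL).2 hxb⟩
    have hxB : x ∈ Icc (-B) B := hKB (hLK hxL)
    have hev := eventually_prod_le_of_subexponential hB0 hD hB hdef hP hxI hxB
      (fun δ hδ => eventually_abs_eval_le_of_regular hB0 hD hB hKB hμK hKfin hdef hP hlim hτK hyK
        hyτ hy hxB hx hδ) hcpos hzB (half_pos hε)
    filter_upwards [hev, eventually_gt_atTop 0] with n hn hn0 hsmall
    have hn' : (0 : ℝ) < n := by exact_mod_cast hn0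
    have h4 := ofReal_le_sum_scaledKernel hD0 Finset.univ (z n) x (n * (w + ε / 2)) (by
      refine (hn (by rwa [← hz n])).trans_eq ?_
      rw [hc, Finset.card_univ, Fintype.card_fin, mul_assoc, ← Real.exp_add, mul_pow,
        ← Real.exp_nat_mul]
      congr 2
      ring)
    rw [ENNReal.ofReal_mul hn'.le, ENNReal.ofReal_natCast] at h4
    rw [mul_comm, ← div_eq_mul_inv, ENNReal.le_div_iff_mul_le (by simp [hn0.ne']) (by simp),
      mul_comm]
    exact h4
  by_contra hcon
  rw [not_eventually] at hcon
  obtain ⟨φ, hφ, hφs⟩ := extraction_of_frequently_atTop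
    (hcon.and_eventually (eventually_gt_atTop 0))
  -- The threshold in `hgood` depends on `x`; Fatou's lemma replaces uniformity.
  have hfatou := lintegral_liminf_le (μ := (ω : Measure ℝ)) (u := atTop)
    (f := fun k x => ((φ k : ℕ) : ℝ≥0∞)⁻¹ * ∑ i, scaledKernel D x (z (φ k) i))
    (fun k => (Finset.measurable_sum _ fun i _ => measurable_scaledKernel_left D _).const_mul _)
  have hleft : ENNReal.ofReal (w + ε / 2) ≤ ∫⁻ x, liminf (fun k =>
      ((φ k : ℕ) : ℝ≥0∞)⁻¹ * ∑ i, scaledKernel D x (z (φ k) i)) atTop ∂(ω : Measure ℝ) := by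
    calc ENNReal.ofReal (w + ε / 2)
        = ∫⁻ _, ENNReal.ofReal (w + ε / 2) ∂(ω : Measure ℝ) := by simp
      _ ≤ _ := by
          refine lintegral_mono_ae ?_
          filter_upwards [hgood] with x hx
          refine le_liminf_of_le (by isBoundedDefault) ?_
          filter_upwards [hφ.tendsto_atTop.eventually hx] with k hk
          exact hk (not_le.1 (hφs k).1).le
  have hright : liminf (fun k => ∫⁻ x, ((φ k : ℕ) : ℝ≥0∞)⁻¹ * ∑ i, scaledKernel D x (z (φ k) i)
      ∂(ω : Measure ℝ)) atTop ≤ ENNReal.ofReal w := by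
    have : ∀ k, ∫⁻ x, ((φ k : ℕ) : ℝ≥0∞)⁻¹ * ∑ i, scaledKernel D x (z (φ k) i)
        ∂(ω : Measure ℝ) ≤ ENNReal.ofReal w := by
      intro k
      have hk0 : 0 < φ k := (hφs k).2
      rw [lintegral_const_mul _ (Finset.measurable_sum _ fun i _ =>
          measurable_scaledKernel_left D _),
        lintegral_finsetSum _ fun i _ => measurable_scaledKernel_left D _]
      -- By symmetry this is the potential of `ω` at a zero `t`, which may lie outside `L`; hence
      -- the bound on the whole line is essential.
      have h1 : ∀ t, ∫⁻ x, scaledKernel D x t ∂(ω : Measure ℝ) ≤ ENNReal.ofReal w := by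
        intro t
        simp_rw [scaledKernel_comm D _ t]
        rw [hw, ENNReal.ofReal_toReal hLfin]
        exact scaledPotential_le_minEnergy hωL hω hLfin t
      rw [ENNReal.inv_mul_le_iff (by simp [hk0.ne']) (by simp)]
      refine (Finset.sum_le_sum fun i _ => h1 _).trans ?_
      simp
    exact liminf_le_of_le (by isBoundedDefault) fun b hb => by
      obtain ⟨k, hk⟩ := hb.exists
      exact hk.trans (this k)
  have h := hleft.trans (hfatou.trans hright)
  rw [ENNReal.ofReal_le_ofReal_iff ENNReal.toReal_nonneg] at h
  linarith

end Restriction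

/-! ### The theorem -/

theorem theorem6p4 (E : Set ℝ) (hE : IsCompact E) (a b : ℝ) (hI : Icc a b ⊆ E)
    (μ : Measure ℝ) [IsFiniteMeasure μ] (hsupp : μ.support ⊆ E)
    (hreg : IsStahlTotikRegular μ)
    (hcap : 0 < logCapacity (μ.restrict (Icc a b)).support) :
    IsStahlTotikRegular (μ.restrict (Icc a b)) := by
  obtain ⟨hK, P, hP, hlim⟩ := hreg
  obtain ⟨B₀, hB₀⟩ := hE.exists_bound_of_continuousOn (f := fun x : ℝ => x) continuousOn_id
  set B := max 1 B₀ with hBdef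
  have hB1 : 1 ≤ B := le_max_left _ _
  have hB0 : 0 < B := by linarith
  have hEB : E ⊆ Icc (-B) B := fun x hx => by
    have h : |x| ≤ B := (hB₀ x hx).trans (le_max_right _ _)
    exact abs_le.1 h
  set D := 2 * B with hD
  have hD1 : 1 ≤ D := by linarith
  have hD0 : 0 < D := by linarith
  have hdist : ∀ x ∈ Icc (-B) B, ∀ y ∈ Icc (-B) B, |x - y| ≤ D := by
    intro x hx y hy
    rw [abs_le]
    constructor <;> linarith [hx.1, hx.2, hy.1, hy.2]
  set K := μ.support
  set L := (μ.restrict (Icc a b)).support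
  have hKB : K ⊆ Icc (-B) B := hsupp.trans hEB
  have hLK : L ⊆ K := Measure.support_mono Measure.restrict_le_self
  have hLab : L ⊆ Icc a b := by
    refine Measure.support_subset_of_isClosed isClosed_Icc ?_
    exact ae_restrict_mem measurableSet_Icc
  have hLc : IsCompact L := hK.of_isClosed_subset Measure.isClosed_support hLK
  have hKD : ∀ x ∈ K, ∀ y ∈ K, |x - y| ≤ D := fun x hx y hy => hdist x (hKB hx) y (hKB hy)
  have hLD : ∀ x ∈ L, ∀ y ∈ L, |x - y| ≤ D := fun x hx y hy => hKD x (hLK hx) y (hLK hy)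
  have hLfin : minEnergy D L ≠ ⊤ := minEnergy_ne_top hD1 hLD hcap
  have hKfin : minEnergy D K ≠ ⊤ := ne_top_of_le_ne_top hLfin (minEnergy_anti D hLK)
  have hμK : μ Kᶜ = 0 := Measure.measure_compl_support
  have hνL : (μ.restrict (Icc a b)) Lᶜ = 0 := Measure.measure_compl_support
  have hB : μ (Icc (-B) B)ᶜ = 0 := measure_mono_null (compl_subset_compl.2 hKB) hμK
  have hBν : (μ.restrict (Icc a b)) (Icc (-B) B)ᶜ = 0 :=
    Measure.absolutelyContinuous_of_le Measure.restrict_le_self hB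
  have hdef := integral_sq_pos hB hKfin
  have hdefν := integral_sq_pos hBν hLfin
  obtain ⟨Q, hQ⟩ := exists_isMonicOrthogonal hBν hdefν
  have hlog : ∀ w : ℝ, Real.log (D * Real.exp (-w)) = Real.log D - w := fun w => by
    rw [Real.log_mul hD0.ne' (Real.exp_pos _).ne', Real.log_exp]; ring
  -- Both regularity statements become limits of logarithms, log ‖·‖ / n → log D - minimal energy.
  refine ⟨hLc, Q, hQ, ?_⟩
  simp_rw [eLpNorm_polynomial_eq hBν]
  simp_rw [eLpNorm_polynomial_eq hB] at hlim
  rw [logCapacity_eq_ofReal hD1 hKD hKfin, tendsto_ofReal_rpow_iff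
    (fun n => Real.sqrt_pos.2 (hdef _ (hP.monic n).ne_zero)) (by positivity), hlog] at hlim
  rw [logCapacity_eq_ofReal hD1 hLD hLfin, tendsto_ofReal_rpow_iff
    (fun n => Real.sqrt_pos.2 (hdefν _ (hQ.monic n).ne_zero)) (by positivity), hlog]
  rw [tendsto_order]
  constructor
  · intro r hr
    -- Half of the gap, so that the resulting bound stays strictly above `r`.
    have hε : 0 < (Real.log D - (minEnergy D L).toReal - r) / 2 := by linarith
    filter_upwards [eventually_pow_le_norm_restrict hB0 le_rfl hB hdef hP hK hKB hμK hlim hLc hLK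
      hLab hLfin hdefν hQ hε, eventually_gt_atTop 0] with n hn hn0
    have hn' : (0 : ℝ) < n := by exact_mod_cast hn0
    have h1 := Real.log_le_log (by positivity) hn
    rw [Real.log_pow, Real.log_mul hD0.ne' (Real.exp_pos _).ne', Real.log_exp] at h1
    rw [lt_div_iff₀ hn']
    nlinarith
  · intro r hr
    filter_upwards [eventually_log_norm_div_lt hD0 hBν hLc hLD hLfin hνL hdefν hQ
      (ε := r - (Real.log D - (minEnergy D L).toReal)) (by linarith)] with n hn
    linarith
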